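/- Let $\hat q,\hat p$ be the position and momentum operators on $L^2(\mathbb R)$ ($\hbar=1$), $\hat a=(\hat q+i\hat p)/\sqrt2$, $\hat n=\hat a^\dagger\hat a$, let $|n\rangle_f$ be the Fock states, and let $\hat F=\exp(\pi i\hat n/2)$ be the Fourier operator. For $\mathbf r=(r_1,r_2)$ let $\hat V(\mathbf r)=e^{-ir_1r_2/2}\,e^{ir_1\hat q}e^{-ir_2\hat p}$. For an integer $d\ge 1$ put $\alpha_d=\sqrt{2\pi/d}$, and for $j\in\{0,\dots,d-1\}$ let $$|j^{(\mathrm{ideal})}\rangle=\sqrt{\alpha_d d}\,\sum_{s\in\mathbb Z}|\alpha_d(ds+j)\rangle_{\hat q}$$ (a Dirac comb, as a tempered distribution). For $\beta>0$ and for real $\gamma,\delta$ with $0<\gamma\delta<2$ define the vectors of $L^2(\mathbb R)$ $$|j^{(3)}_\beta\rangle=\frac1{\sqrt{N^{(3)}_{\beta,j}}}\,e^{-\beta(\hat n+\frac12)}|j^{(\mathrm{ideal})}\rangle,\qquad |j^{(2)}_{\gamma,\delta}\rangle=\frac1{\sqrt{N^{(2)}_{\gamma,\delta,j}}}\iint\frac{dr_1dr_2}{2\pi\gamma\delta}\,e^{-\frac{r_1^2}{2\gamma^2}-\frac{r_2^2}{2\delta^2}}\,\hat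 V(\mathbf r)|j^{(\mathrm{ideal})}\rangle,$$ where $N^{(3)}_{\beta,j},N^{(2)}_{\gamma,\delta,j}>0$ are the constants that make these unit vectors (the unnormalized vectors lie in $L^2(\mathbb R)$ and are nonzero). Then: (1) For all $\beta>0$ and all $j$, $$\hat F^\dagger|j^{(3)}_\beta\rangle=\frac1{\sqrt d}\sum_{j'=0}^{d-1}e^{-2\pi i jj'/d}\sqrt{\frac{N^{(3)}_{\beta,j'}}{N^{(3)}_{\beta,j}}}\;|j'^{(3)}_\beta\rangle .$$ Hence the code space $\mathrm{span}\{|j^{(3)}_\beta\rangle:0\le j<d\}$ is mapped onto itself by $\hat F$. (2) For all real $\gamma,\delta$ with $0<\gamma\delta<2$ and every $j$, the same relation $$\hat F^\dagger|j^{(2)}_{\gamma,\delta}\rangle=\frac1{\sqrt d}\sum_{j'=0}^{d-1}e^{-2\pi i jj'/d}\sqrt{\frac{N^{(2)}_{\gamma,\delta,j'}}{N^{(2)}_{\gamma,\delta,j}}}\;|j'^{(2)}_{\gamma,\delta}\rangle$$ holds if and only if $\gamma=\delta$. -/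

import Mathlib

open MeasureTheory SchwartzMap
open scoped InnerProductSpace ContDiff Nat
noncomputable section
namespace GKP

/-- The Hilbert space `L²(ℝ)` of one oscillator mode, in the position representation. -/
abbrev L2 : Type := Lp ℂ 2 (volume : Measure ℝ)

theorem pow_mul_gauss_le (m : ℕ) (x : ℝ) :
    |x| ^ m * Real.exp (-(x ^ 2 / 2)) ≤ m ! * Real.exp 1 := by
  have h1 : |x| ^ m ≤ m ! * Real.exp |x| := by
    have := Real.pow_div_factorial_le_exp |x| (abs_nonneg x) m
    rwa [div_le_iff₀ (by positivity), mul_comm] at this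
  calc _ ≤ m ! * Real.exp |x| * Real.exp (-(x ^ 2 / 2)) := by gcongr
    _ = m ! * Real.exp (|x| - x ^ 2 / 2) := by rw [mul_assoc, ← Real.exp_add, sub_eq_add_neg]
    _ ≤ _ := by
      gcongr
      nlinarith [sq_nonneg (|x| - 1), sq_abs x]

/-- The Gaussian `exp (-x² / 2)` as a Schwartz function. -/
def gaussianSchwartz : 𝓢(ℝ, ℝ) where
  toFun x := Real.exp (-(x ^ 2 / 2))
  smooth' := by fun_prop
  decay' k n := by
    refine ⟨∑ i ∈ Finset.range ((Polynomial.hermite n).natDegree + 1),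
      |((Polynomial.hermite n).coeff i : ℝ)| * ((i + k) ! * Real.exp 1), fun x => ?_⟩
    rw [norm_iteratedFDeriv_eq_norm_iteratedDeriv, iteratedDeriv_eq_iterate,
      Polynomial.deriv_gaussian_eq_hermite_mul_gaussian, Polynomial.aeval_eq_sum_range]
    simp only [Real.norm_eq_abs, abs_mul, abs_pow, abs_neg, abs_one, one_pow, one_mul, Real.abs_exp]
    calc _ ≤ |x| ^ k * ((∑ i ∈ Finset.range ((Polynomial.hermite n).natDegree + 1),
            |((Polynomial.hermite n).coeff i : ℝ)| * |x| ^ i) * Real.exp (-(x ^ 2 / 2))) := by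
          gcongr
          refine (Finset.abs_sum_le_sum_abs _ _).trans (le_of_eq ?_)
          refine Finset.sum_congr rfl fun i _ => ?_
          rw [zsmul_eq_mul, abs_mul, abs_pow]
      _ = ∑ i ∈ Finset.range ((Polynomial.hermite n).natDegree + 1),
            |((Polynomial.hermite n).coeff i : ℝ)| * (|x| ^ (i + k) * Real.exp (-(x ^ 2 / 2))) := by
          rw [Finset.sum_mul, Finset.mul_sum]
          refine Finset.sum_congr rfl fun i _ => ?_
          rw [pow_add]; ring
      _ ≤ _ := by
          refine Finset.sum_le_sum fun i _ => ?_
          exact mul_le_mul_of_nonneg_left (pow_mul_gauss_le _ _) (abs_nonneg _)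

/-- The vacuum `|0⟩_f`, with wave function `π^(-1/4) exp (-x² / 2)`. -/
def vacuum : 𝓢(ℝ, ℂ) :=
  ((Real.pi ^ (-(1 / 4) : ℝ) : ℝ) : ℂ) • gaussianSchwartz.postcompCLM Complex.ofRealCLM

/-- The position operator `q̂` (multiplication by `x`) on Schwartz functions. -/
def position : 𝓢(ℝ, ℂ) →L[ℂ] 𝓢(ℝ, ℂ) := smulLeftCLM ℂ (fun x : ℝ => (x : ℂ))
/-- The momentum operator `p̂ = -i d/dx` on Schwartz functions (`ħ = 1`). -/
def momentum : 𝓢(ℝ, ℂ) →L[ℂ] 𝓢(ℝ, ℂ) := (-Complex.I) • derivCLM ℂ ℂ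
/-- The annihilation operator `â = (q̂ + i p̂) / √2`. -/
def annihilation : 𝓢(ℝ, ℂ) →L[ℂ] 𝓢(ℝ, ℂ) :=
  ((√2 : ℝ) : ℂ)⁻¹ • (position + Complex.I • momentum)
/-- The creation operator `â† = (q̂ - i p̂) / √2`. -/
def creation : 𝓢(ℝ, ℂ) →L[ℂ] 𝓢(ℝ, ℂ) :=
  ((√2 : ℝ) : ℂ)⁻¹ • (position - Complex.I • momentum)
/-- The number operator `n̂ = â† â` on Schwartz functions. -/
def number : 𝓢(ℝ, ℂ) →L[ℂ] 𝓢(ℝ, ℂ) := creation ∘L annihilation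

/-- The Fock state `|n⟩_f = (â†)ⁿ |0⟩_f / √(n!)`; its wave function is real-valued. -/
def fockS : ℕ → 𝓢(ℝ, ℂ)
  | 0 => vacuum
  | n + 1 => ((√(n + 1) : ℝ) : ℂ)⁻¹ • creation (fockS n)

/-- The Fock state `|n⟩_f` as a vector of `L²(ℝ)`. -/
def fock (n : ℕ) : L2 := (fockS n).toLp 2

theorem vacuum_apply (x : ℝ) :
    vacuum x = ((Real.pi ^ (-(1 / 4) : ℝ) * Real.exp (-(x ^ 2 / 2)) : ℝ) : ℂ) := by
  have : gaussianSchwartz x = Real.exp (-(x ^ 2 / 2)) := rfl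
  simp [vacuum, this]

theorem position_apply (f : 𝓢(ℝ, ℂ)) (x : ℝ) : position f x = x * f x := by
  have h : (fun x : ℝ => (x : ℂ)).HasTemperateGrowth := by fun_prop
  simp [position, smulLeftCLM_apply_apply h]

theorem annihilation_apply (f : 𝓢(ℝ, ℂ)) (x : ℝ) :
    annihilation f x = ((√2 : ℝ) : ℂ)⁻¹ * (x * f x + deriv f x) := by
  simp [annihilation, momentum, position_apply, ← mul_assoc]; ring

theorem creation_apply (f : 𝓢(ℝ, ℂ)) (x : ℝ) :
    creation f x = ((√2 : ℝ) : ℂ)⁻¹ * (x * f x - deriv f x) := by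
  simp [creation, momentum, position_apply, ← mul_assoc]; ring

theorem sqrt_two_inv_mul : ((√2 : ℝ) : ℂ)⁻¹ * ((√2 : ℝ) : ℂ)⁻¹ = 1 / 2 := by
  rw [← mul_inv, ← Complex.ofReal_mul, Real.mul_self_sqrt (by norm_num)]; norm_num

theorem annihilation_creation (f : 𝓢(ℝ, ℂ)) :
    annihilation (creation f) = number f + f := by
  ext x
  have hx : HasDerivAt (fun y : ℝ => (y : ℂ)) 1 x := Complex.ofRealCLM.hasDerivAt
  have hf := f.hasDerivAt x
  have hf' : HasDerivAt (deriv f) (deriv (deriv f) x) x := (derivCLM ℂ ℂ f).hasDerivAt x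
  have h1 : deriv (creation f) x =
      ((√2 : ℝ) : ℂ)⁻¹ * (f x + x * deriv f x - deriv (deriv f) x) := by
    have : (creation f : ℝ → ℂ) = fun y => ((√2 : ℝ) : ℂ)⁻¹ * (y * f y - deriv f y) :=
      funext (creation_apply f)
    rw [this]; refine (((hx.mul hf).sub hf').const_mul _).deriv.trans ?_; ring
  have h2 : deriv (annihilation f) x =
      ((√2 : ℝ) : ℂ)⁻¹ * (f x + x * deriv f x + deriv (deriv f) x) := by
    have : (annihilation f : ℝ → ℂ) = fun y => ((√2 : ℝ) : ℂ)⁻¹ * (y * f y + deriv f y) :=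
      funext (annihilation_apply f)
    rw [this]; refine (((hx.mul hf).add hf').const_mul _).deriv.trans ?_; ring
  simp only [number, ContinuousLinearMap.comp_apply, add_apply]
  rw [annihilation_apply, creation_apply, creation_apply, annihilation_apply, h1, h2]
  linear_combination 2 * f x * sqrt_two_inv_mul

theorem annihilation_vacuum : annihilation vacuum = 0 := by
  ext x
  have : (vacuum : ℝ → ℂ) =
      fun x => ((Real.pi ^ (-(1 / 4) : ℝ) * Real.exp (-(x ^ 2 / 2)) : ℝ) : ℂ) :=
    funext vacuum_apply
  have h : HasDerivAt vacuum (-x * vacuum x) x := by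
    have h0 : HasDerivAt (fun x : ℝ => Real.pi ^ (-(1 / 4) : ℝ) * Real.exp (-(x ^ 2 / 2)))
        (-x * (Real.pi ^ (-(1 / 4) : ℝ) * Real.exp (-(x ^ 2 / 2)))) x := by
      have := (((hasDerivAt_pow 2 x).div_const 2).neg.exp).const_mul (Real.pi ^ (-(1 / 4) : ℝ))
      refine this.congr_deriv ?_
      simp only [Pi.neg_apply]
      push_cast; ring
    rw [this]
    convert h0.ofReal_comp using 1
    push_cast; ring
  rw [annihilation_apply, h.deriv]
  simp

theorem sqrt_succ_mul_self (n : ℕ) :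
    ((√(n + 1) : ℝ) : ℂ) * ((√(n + 1) : ℝ) : ℂ) = (n + 1 : ℂ) := by
  rw [← Complex.ofReal_mul, Real.mul_self_sqrt (by positivity)]; push_cast; rfl

/-- `n̂ |n⟩_f = n |n⟩_f`. -/
theorem number_fockS (n : ℕ) : number (fockS n) = (n : ℂ) • fockS n := by
  induction n with
  | zero => simp [fockS, number, annihilation_vacuum]
  | succ n ih =>
    have : number (fockS (n + 1)) =
        ((√(n + 1) : ℝ) : ℂ)⁻¹ • creation (annihilation (creation (fockS n))) := by
      simp [fockS, number]
    rw [this, annihilation_creation, ih, fockS]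
    simp only [map_add, map_smul, smul_smul, smul_add]
    rw [← add_smul]
    congr 1
    push_cast; ring

theorem inner_creation (f g : 𝓢(ℝ, ℂ)) :
    ⟪(creation f).toLp 2 volume, g.toLp 2 volume⟫_ℂ =
      ⟪f.toLp 2 volume, (annihilation g).toLp 2 volume⟫_ℂ := by
  rw [inner_toL2_toL2_eq _ _ volume, inner_toL2_toL2_eq _ _ volume]
  let L : ℂ →L[ℝ] ℂ →L[ℝ] ℂ :=
    (ContinuousLinearMap.mul ℝ ℂ).comp (Complex.conjCLE : ℂ →L[ℝ] ℂ)
  have hL : ∀ u v : ℂ, L u v = starRingEnd ℂ u * v := fun u v => by simp [L]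
  have hp := integral_bilinear_deriv_right_eq_neg_left f g L
  have i1 : Integrable (fun x => L (f x) (deriv g x)) := (pairing L f (derivCLM ℂ ℂ g)).integrable
  have i2 : Integrable (fun x => L (deriv f x) (g x)) := (pairing L (derivCLM ℂ ℂ f) g).integrable
  have i3 : Integrable (fun x => L (f x) (position g x)) := (pairing L f (position g)).integrable
  simp only [hL] at hp i1 i2 i3
  have e1 : ∀ x, ⟪creation f x, g x⟫_ℂ = ((√2 : ℝ) : ℂ)⁻¹ *
      (starRingEnd ℂ (f x) * position g x - starRingEnd ℂ (deriv f x) * g x) := fun x => by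
    rw [creation_apply, position_apply]; simp; ring
  have e2 : ∀ x, ⟪f x, annihilation g x⟫_ℂ = ((√2 : ℝ) : ℂ)⁻¹ *
      (starRingEnd ℂ (f x) * position g x + starRingEnd ℂ (f x) * deriv g x) := fun x => by
    rw [annihilation_apply, position_apply]; simp; ring
  simp only [e1, e2]
  rw [integral_const_mul, integral_const_mul, integral_sub i3 i2, integral_add i3 i1, hp]
  ring

theorem toLp_smul (c : ℂ) (f : 𝓢(ℝ, ℂ)) :
    (c • f).toLp 2 volume = c • f.toLp 2 (volume : Measure ℝ) :=
  (toLpCLM ℂ ℂ 2 (volume : Measure ℝ)).map_smul c f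

theorem inner_number (f g : 𝓢(ℝ, ℂ)) :
    ⟪(number f).toLp 2 volume, g.toLp 2 volume⟫_ℂ =
      ⟪f.toLp 2 volume, (number g).toLp 2 volume⟫_ℂ := by
  have h1 := inner_creation (annihilation f) g
  have h2 := inner_creation (annihilation g) f
  calc _ = _ := h1
    _ = starRingEnd ℂ ⟪(annihilation g).toLp 2 volume, (annihilation f).toLp 2 volume⟫_ℂ :=
        (inner_conj_symm _ _).symm
    _ = starRingEnd ℂ ⟪(number g).toLp 2 volume, f.toLp 2 volume⟫_ℂ := by rw [← h2]; rfl
    _ = _ := inner_conj_symm _ _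

theorem inner_vacuum : ⟪vacuum.toLp 2 volume, vacuum.toLp 2 volume⟫_ℂ = 1 := by
  rw [inner_toL2_toL2_eq _ _ volume]
  have e : ∀ x, ⟪vacuum x, vacuum x⟫_ℂ =
      ((Real.pi ^ (-(1 / 2) : ℝ) * Real.exp (-1 * x ^ 2) : ℝ) : ℂ) := fun x => by
    rw [vacuum_apply, RCLike.inner_apply, Complex.conj_ofReal, ← Complex.ofReal_mul]
    congr 1
    have h1 : Real.pi ^ (-(1 / 2) : ℝ) = Real.pi ^ (-(1 / 4) : ℝ) * Real.pi ^ (-(1 / 4) : ℝ) := by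
      rw [← Real.rpow_add Real.pi_pos]; norm_num
    have h2 : Real.exp (-1 * x ^ 2) = Real.exp (-(x ^ 2 / 2)) * Real.exp (-(x ^ 2 / 2)) := by
      rw [← Real.exp_add]; congr 1; ring
    rw [h1, h2]; ring
  simp only [e]
  rw [integral_complex_ofReal, integral_const_mul, integral_gaussian, div_one, Real.sqrt_eq_rpow,
    ← Real.rpow_add Real.pi_pos]
  norm_num

theorem orthonormal_fock : Orthonormal ℂ fock := by
  have hn : ∀ n, ⟪fock n, fock n⟫_ℂ = 1 := fun n => by
    induction n with
    | zero => exact inner_vacuum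
    | succ n ih =>
      have h0 : ((√(n + 1) : ℝ) : ℂ) ≠ 0 := by
        rw [Complex.ofReal_ne_zero]; positivity
      have h1 : ((n : ℂ) + 1) ≠ 0 := by exact_mod_cast Nat.succ_ne_zero n
      have h2 : annihilation (creation (fockS n)) = ((n : ℂ) + 1) • fockS n := by
        rw [annihilation_creation, number_fockS, add_smul, one_smul]
      have h3 := inner_creation (fockS n) (creation (fockS n))
      rw [h2, toLp_smul, inner_smul_right] at h3
      change ⟪(fockS (n + 1)).toLp 2 volume, (fockS (n + 1)).toLp 2 volume⟫_ℂ = 1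
      change ⟪(fockS n).toLp 2 volume, (fockS n).toLp 2 volume⟫_ℂ = 1 at ih
      rw [fockS, toLp_smul, inner_smul_left, inner_smul_right, h3, ih, ← Complex.ofReal_inv,
        Complex.conj_ofReal, Complex.ofReal_inv, mul_one, ← sqrt_succ_mul_self]
      field_simp
  rw [orthonormal_iff_ite]
  intro m n
  split_ifs with h
  · rw [← h, hn]
  · have := inner_number (fockS m) (fockS n)
    rw [number_fockS, number_fockS, toLp_smul, toLp_smul, inner_smul_left, inner_smul_right,
      Complex.conj_natCast] at this
    have h' : ((m : ℂ) - n) ≠ 0 := sub_ne_zero.2 (by exact_mod_cast h)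
    change ⟪(fockS m).toLp 2 volume, (fockS n).toLp 2 volume⟫_ℂ = 0
    refine (mul_eq_zero.1 (?_ : ((m : ℂ) - n) * _ = 0)).resolve_left h'
    rw [sub_mul, this, sub_self]

theorem norm_phase (n : ℕ) : ‖Complex.exp (Real.pi * Complex.I * n / 2)‖ = 1 := by
  rw [show (Real.pi * Complex.I * n / 2 : ℂ) = ((Real.pi * n / 2 : ℝ) : ℂ) * Complex.I by
    push_cast; ring]
  exact Complex.norm_exp_ofReal_mul_I _

theorem summable_phase (f : L2) : Summable fun n : ℕ =>
    (Complex.exp (Real.pi * Complex.I * n / 2) * ⟪fock n, f⟫_ℂ) • fock n := by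
  have h := orthonormal_fock.orthogonalFamily.summable_iff_norm_sq_summable
    (fun n => Complex.exp (Real.pi * Complex.I * n / 2) * ⟪fock n, f⟫_ℂ)
  simp only [LinearIsometry.toSpanSingleton_apply] at h
  rw [h]
  simp only [norm_mul, norm_phase, one_mul]
  exact orthonormal_fock.inner_products_summable f

/-- The Fourier operator `F̂ = exp (π i n̂ / 2) = ∑ₙ exp (π i n / 2) |n⟩⟨n|_f`, a bounded operator
on `L²(ℝ)`. -/
def fourierOp : L2 →L[ℂ] L2 :=
  LinearMap.mkContinuous
    { toFun := fun f => ∑' n : ℕ,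
        (Complex.exp (Real.pi * Complex.I * n / 2) * ⟪fock n, f⟫_ℂ) • fock n
      map_add' := fun f g => by
        rw [← (summable_phase f).tsum_add (summable_phase g)]
        simp only [inner_add_right, mul_add, add_smul]
      map_smul' := fun c f => by
        rw [RingHom.id_apply, ← tsum_const_smul'']
        simp only [inner_smul_right, smul_smul, mul_left_comm] }
    1 fun f => by
      rw [one_mul]
      refine le_of_tendsto (summable_phase f).hasSum.norm (Filter.Eventually.of_forall fun s => ?_)
      have h := orthonormal_fock.orthogonalFamily.norm_sum
        (fun n => Complex.exp (Real.pi * Complex.I * n / 2) * ⟪fock n, f⟫_ℂ) s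
      simp only [LinearIsometry.toSpanSingleton_apply, norm_mul, norm_phase, one_mul] at h
      refine (sq_le_sq₀ (norm_nonneg _) (norm_nonneg _)).1 ?_
      exact h.trans_le (orthonormal_fock.sum_inner_products_le f)

/-- The displacement `X̂(r) = exp (-i r p̂)` on tempered distributions: it translates by `r`,
`f(q) ↦ f(q - r)`. -/
def dispX (r : ℝ) : 𝓢'(ℝ, ℂ) →L[ℂ] 𝓢'(ℝ, ℂ) :=
  PointwiseConvergenceCLM.precomp ℂ (compSubConstCLM ℂ (-r))

/-- The displacement `Ẑ(r) = exp (i r q̂)` on tempered distributions: `f(q) ↦ exp (i r q) f(q)`. -/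
def dispZ (r : ℝ) : 𝓢'(ℝ, ℂ) →L[ℂ] 𝓢'(ℝ, ℂ) :=
  TemperedDistribution.smulLeftCLM ℂ (fun q : ℝ => Complex.exp (Complex.I * r * q))

/-- The Weyl-Heisenberg displacement `V̂(r) = exp (-i r_p r_q / 2) Ẑ(r_p) X̂(r_q)`, for
`r = (r_p, r_q)`. -/
def dispV (r : ℝ × ℝ) : 𝓢'(ℝ, ℂ) →L[ℂ] 𝓢'(ℝ, ℂ) :=
  Complex.exp (-Complex.I * r.1 * r.2 / 2) • (dispZ r.1 ∘L dispX r.2)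

/-- `α_d = √(2π / d)`. -/
def alpha (d : ℕ) : ℝ := √(2 * Real.pi / d)

/-- The ideal code state `√(α_d d) ∑_{s ∈ ℤ} |α_d (d s + j)⟩_q`, a Dirac comb. The sum is taken in
the space of tempered distributions with the topology of pointwise convergence. -/
def idealState (d : ℕ) (j : Fin d) : 𝓢'(ℝ, ℂ) :=
  ((√(alpha d * d) : ℝ) : ℂ) •
    ∑' s : ℤ, TemperedDistribution.delta (alpha d * (d * s + (j : ℕ)))

/-- The unnormalized state `exp (-β (n̂ + 1/2)) |j_ideal⟩ = ∑ₙ exp (-β (n + 1/2)) ⟨n|j_ideal⟩ |n⟩`,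
with the sum in `L²(ℝ)`. Since the Fock wave functions are real, `⟨n|j_ideal⟩` is the value of the
distribution at the Fock wave function. -/
def approx3Vec (d : ℕ) (β : ℝ) (j : Fin d) : L2 :=
  ∑' n : ℕ, (((Real.exp (-β * (n + 1 / 2)) : ℝ) : ℂ) * idealState d j (fockS n)) • fock n

/-- The normalization constant of Approximation 3. -/
def N3 (d : ℕ) (β : ℝ) (j : Fin d) : ℝ := ‖approx3Vec d β j‖ ^ 2

/-- The logical basis state of Approximation 3. -/
def ket3 (d : ℕ) (β : ℝ) (j : Fin d) : L2 := (((√(N3 d β j))⁻¹ : ℝ) : ℂ) • approx3Vec d β j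

/-- The code space of Approximation 3. -/
def codeSpace3 (d : ℕ) (β : ℝ) : Submodule ℂ L2 := Submodule.span ℂ (Set.range (ket3 d β))

/-- The Gaussian error wave function
`exp (-r₁² / (2γ²) - r₂² / (2δ²)) / (2πγδ)`, for `r = (r₁, r₂) = (r_p, r_q)`. -/
def errorWave (γ δ : ℝ) (r : ℝ × ℝ) : ℝ :=
  Real.exp (-(r.1 ^ 2 / (2 * γ ^ 2)) - r.2 ^ 2 / (2 * δ ^ 2)) / (2 * Real.pi * γ * δ)

/-- The vector `f` of `L²(ℝ)` is the (weak) integral `∬ errorWave(r) V̂(r) |j_ideal⟩ dr₁ dr₂` in the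
space of tempered distributions. -/
def IsApprox2Vec (d : ℕ) (γ δ : ℝ) (j : Fin d) (f : L2) : Prop :=
  ∀ u : 𝓢(ℝ, ℂ),
    Integrable (fun r : ℝ × ℝ => (errorWave γ δ r : ℂ) * dispV r (idealState d j) u) ∧
    (f : 𝓢'(ℝ, ℂ)) u = ∫ r : ℝ × ℝ, (errorWave γ δ r : ℂ) * dispV r (idealState d j) u

open Classical in
/-- The unnormalized state `∬ errorWave(r) V̂(r) |j_ideal⟩ dr₁ dr₂`: the unique vector of `L²(ℝ)` that
is this weak integral (and `0`, should there be none). -/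
def approx2Vec (d : ℕ) (γ δ : ℝ) (j : Fin d) : L2 :=
  if h : ∃ f : L2, IsApprox2Vec d γ δ j f then h.choose else 0

/-- The normalization constant of Approximation 2. -/
def N2 (d : ℕ) (γ δ : ℝ) (j : Fin d) : ℝ := ‖approx2Vec d γ δ j‖ ^ 2

/-- The logical basis state of Approximation 2. -/
def ket2 (d : ℕ) (γ δ : ℝ) (j : Fin d) : L2 :=
  (((√(N2 d γ δ j))⁻¹ : ℝ) : ℂ) • approx2Vec d γ δ j

/-- The entry `exp (-2π i j k / d) / √d` of the unitary discrete Fourier transform. -/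
def dftCoeff (d : ℕ) (j k : Fin d) : ℂ :=
  Complex.exp (-(2 * Real.pi * Complex.I * (j : ℕ) * (k : ℕ) / d)) / ((√d : ℝ) : ℂ)

end GKP

end

/-!
The inverse Fourier operator acts on the ideal states as a finite Fourier transform: this is Poisson
summation, as the momentum lattice dual to the position lattice `α_d d ℤ` is `α_d ℤ`.

It acts diagonally on the Fock basis and hence commutes with the damping `e^{-β(n̂ + 1/2)}`. The
first relation therefore descends from the ideal states to their damped versions.

On phase space it is the rotation by a quarter turn, which exchanges the two widths of the Gaussian
error distribution. So it maps the state `v_j(γ, δ)` of Approximation 2 to the finite Fourier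
transform of the states `v_k(δ, γ)`, and as it is injective, the second relation says that
`v_j(γ, δ) = v_j(δ, γ)`. The wave function of `v_j(γ, δ)` is `e^{-κ x²}` times a positive periodic
theta series in a multiple of `x`, with `κ = 2γ² / (4 + γ²δ²)`. Since such a series is bounded above
and away from zero, the state determines `κ`, and `γδ > 0` together with `κ(γ, δ) = κ(δ, γ)` forces
`γ = δ`.
-/

noncomputable section

open Filter Topology
open scoped Real FourierTransform

namespace GKP

/-! ### Ladder relations -/

theorem creation_fockS (n : ℕ) : creation (fockS n) = (√(n + 1) : ℂ) • fockS (n + 1) := by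
  have h : ((√(n + 1) : ℝ) : ℂ) ≠ 0 := by
    rw [Complex.ofReal_ne_zero]
    positivity
  rw [fockS, smul_smul, mul_inv_cancel₀ h, one_smul]

theorem annihilation_fockS_succ (n : ℕ) :
    annihilation (fockS (n + 1)) = (√(n + 1) : ℂ) • fockS n := by
  have h : ((√(n + 1) : ℝ) : ℂ) ≠ 0 := by
    rw [Complex.ofReal_ne_zero]
    positivity
  rw [fockS, map_smul, annihilation_creation, number_fockS, inv_smul_eq_iff₀ h, smul_smul,
    sqrt_succ_mul_self, add_smul, one_smul]

theorem position_eq_ladder : position = ((√2 : ℝ) : ℂ)⁻¹ • (annihilation + creation) := by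
  ext f x
  simp only [add_apply, smul_apply]
  simp only [annihilation_apply, creation_apply, position_apply, smul_eq_mul]
  linear_combination (-2 * x * f x) * sqrt_two_inv_mul

theorem derivCLM_eq_ladder : derivCLM ℂ ℂ = ((√2 : ℝ) : ℂ)⁻¹ • (annihilation - creation) := by
  ext f x
  simp only [sub_apply, smul_apply]
  simp only [annihilation_apply, creation_apply, derivCLM_apply, smul_eq_mul]
  linear_combination (-2 * deriv f x) * sqrt_two_inv_mul

theorem creation_eq_position_sub_derivCLM :
    creation = ((√2 : ℝ) : ℂ)⁻¹ • (position - derivCLM ℂ ℂ) := by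
  ext f x
  simp only [sub_apply, smul_apply]
  simp only [creation_apply, position_apply, derivCLM_apply, smul_eq_mul]

theorem conj_deriv {f : ℝ → ℂ} (hf : ∀ x, starRingEnd ℂ (f x) = f x) (x : ℝ) :
    starRingEnd ℂ (deriv f x) = deriv f x := by
  have h : (fun y => star (f y)) = f := funext hf
  rw [starRingEnd_apply, ← deriv.star, h]

theorem conj_fockS (n : ℕ) (x : ℝ) : starRingEnd ℂ (fockS n x) = fockS n x := by
  induction n generalizing x with
  | zero => rw [fockS, vacuum_apply, Complex.conj_ofReal]
  | succ n ih =>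
    rw [fockS, smul_apply, creation_apply, smul_eq_mul]
    simp only [map_mul, map_inv₀, map_sub, Complex.conj_ofReal, ih, conj_deriv ih]

theorem toTemperedDistribution_fockS (f : L2) (n : ℕ) :
    (f : 𝓢'(ℝ, ℂ)) (fockS n) = ⟪fock n, f⟫_ℂ := by
  rw [Lp.toTemperedDistribution_apply, L2.inner_def]
  refine integral_congr_ae ?_
  filter_upwards [(fockS n).coeFn_toLp 2 volume] with x hx
  rw [fock, hx, RCLike.inner_apply, conj_fockS, smul_eq_mul, mul_comm]

/-! ### The unitary Fourier transform -/

/-- The dilation `x ↦ c x` of the real line. -/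
def dilation (c : ℝ) (hc : c ≠ 0) : ℝ ≃L[ℝ] ℝ :=
  ContinuousLinearEquiv.unitsEquivAut ℝ (Units.mk0 c hc)

theorem dilation_apply {c : ℝ} (hc : c ≠ 0) (x : ℝ) : dilation c hc x = c * x := by
  simp [dilation, mul_comm]

/-- The Fourier transform `u ↦ (2π)^(-1/2) ∫ exp (-i x y) u(x) dx` on Schwartz functions, in the
normalization of `fourierOp`. -/
def fourierU : 𝓢(ℝ, ℂ) →L[ℂ] 𝓢(ℝ, ℂ) :=
  ((√(2 * π) : ℝ) : ℂ)⁻¹ •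
    (compCLMOfContinuousLinearEquiv ℂ (dilation (2 * π)⁻¹ (by positivity)) ∘L
      fourierTransformCLM ℂ)

theorem fourierU_apply_eq_fourier (u : 𝓢(ℝ, ℂ)) (y : ℝ) :
    fourierU u y = ((√(2 * π) : ℝ) : ℂ)⁻¹ * 𝓕 u (y * (2 * π)⁻¹) := by
  simp only [fourierU, ContinuousLinearMap.comp_apply, smul_apply, smul_eq_mul,
    fourierTransformCLM_apply, compCLMOfContinuousLinearEquiv_apply, Function.comp_apply,
    dilation_apply, mul_comm y]

theorem fourierU_apply (u : 𝓢(ℝ, ℂ)) (y : ℝ) :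
    fourierU u y =
      ((√(2 * π) : ℝ) : ℂ)⁻¹ * ∫ x : ℝ, Complex.exp (-Complex.I * x * y) * u x := by
  rw [fourierU_apply_eq_fourier, fourier_coe, Real.fourier_real_eq_integral_exp_smul]
  congr 2 with x
  rw [smul_eq_mul]
  congr 2
  push_cast
  field_simp

theorem fourierU_derivCLM (u : 𝓢(ℝ, ℂ)) :
    fourierU (derivCLM ℂ ℂ u) = Complex.I • position (fourierU u) := by
  ext y
  have h : (derivCLM ℂ ℂ u : ℝ → ℂ) = deriv u := funext (derivCLM_apply ℂ u)
  rw [smul_apply, position_apply, fourierU_apply_eq_fourier, fourierU_apply_eq_fourier,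
    fourier_coe, fourier_coe, h,
    Real.fourier_deriv u.integrable u.differentiable (h ▸ (derivCLM ℂ ℂ u).integrable)]
  simp only [smul_eq_mul]
  push_cast
  field_simp

theorem derivCLM_fourierU (u : 𝓢(ℝ, ℂ)) :
    derivCLM ℂ ℂ (fourierU u) = -Complex.I • fourierU (position u) := by
  ext y
  have hu : (fun x : ℝ => (-2 * π * Complex.I * x : ℂ) • u x) =
      ((-2 * π * Complex.I : ℂ) • position u : 𝓢(ℝ, ℂ)) := by
    ext x
    rw [smul_apply, position_apply, smul_eq_mul, smul_eq_mul, mul_assoc]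
  have hx : Integrable fun x : ℝ => x • u x :=
    (position u).integrable.congr (Eventually.of_forall fun x => position_apply u x)
  have hderiv := (((Real.hasDerivAt_fourier u.integrable hx (y * (2 * π)⁻¹)).scomp y
    ((hasDerivAt_id y).mul_const (2 * π)⁻¹)).const_mul ((√(2 * π) : ℝ) : ℂ)⁻¹).deriv
  have hU : (fourierU u : ℝ → ℂ) =
      fun y => ((√(2 * π) : ℝ) : ℂ)⁻¹ * 𝓕 (u : ℝ → ℂ) (y * (2 * π)⁻¹) :=
    funext (fourierU_apply_eq_fourier u)
  rw [derivCLM_apply, hU]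
  refine hderiv.trans ?_
  rw [hu, ← fourier_coe, ← fourierTransformCLM_apply ℂ, map_smul, smul_apply, smul_apply,
    fourierTransformCLM_apply, fourierU_apply_eq_fourier]
  simp only [one_mul, Complex.real_smul, smul_eq_mul]
  push_cast
  field_simp

theorem fourierU_creation (u : 𝓢(ℝ, ℂ)) :
    fourierU (creation u) = -Complex.I • creation (fourierU u) := by
  have h : (-Complex.I) • derivCLM ℂ ℂ (fourierU u) = -fourierU (position u) := by
    rw [derivCLM_fourierU, smul_smul, neg_mul_neg, Complex.I_mul_I, neg_one_smul]
  rw [creation_eq_position_sub_derivCLM, smul_apply, sub_apply, smul_apply, sub_apply, map_smul,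
    map_sub, fourierU_derivCLM, smul_comm (-Complex.I), smul_sub (-Complex.I), h, neg_smul]
  congr 1
  abel

theorem fourierU_vacuum : fourierU vacuum = vacuum := by
  ext y
  have hgauss := fourierIntegral_gaussian (b := 1 / 2) (by norm_num) (-y)
  have hconst : ((π : ℂ) / (1 / 2)) ^ (1 / 2 : ℂ) = ((√(2 * π) : ℝ) : ℂ) := by
    rw [Real.sqrt_eq_rpow, Complex.ofReal_cpow (by positivity)]
    push_cast
    congr 1
    ring
  have hne : ((√(2 * π) : ℝ) : ℂ) ≠ 0 := by
    rw [Complex.ofReal_ne_zero]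
    positivity
  calc fourierU vacuum y
      = ((√(2 * π) : ℝ) : ℂ)⁻¹ * ∫ x : ℝ, ((π ^ (-(1 / 4) : ℝ) : ℝ) : ℂ) *
          (Complex.exp (Complex.I * (-y) * x) * Complex.exp (-(1 / 2) * x ^ 2)) := by
        rw [fourierU_apply]
        congr 2 with x
        rw [vacuum_apply]
        push_cast
        rw [mul_left_comm]
        ring_nf
    _ = vacuum y := by
        rw [integral_const_mul, hgauss, hconst, mul_left_comm, inv_mul_cancel_left₀ hne,
          vacuum_apply]
        push_cast
        ring_nf

theorem fourierU_fockS (n : ℕ) : fourierU (fockS n) = (-Complex.I) ^ n • fockS n := by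
  induction n with
  | zero => rw [fockS, fourierU_vacuum, pow_zero, one_smul]
  | succ n ih =>
    rw [fockS, map_smul, fourierU_creation, ih, map_smul, smul_smul, smul_smul, smul_smul]
    congr 1
    ring

theorem conj_phase (n : ℕ) :
    starRingEnd ℂ (Complex.exp (π * Complex.I * n / 2)) = (-Complex.I) ^ n := by
  have h : starRingEnd ℂ (π * Complex.I * n / 2) = n * -(π / 2 * Complex.I) := by
    simp only [map_div₀, map_mul, Complex.conj_ofReal, Complex.conj_I, map_natCast,
      Complex.conj_ofNat]
    ring
  rw [← Complex.exp_conj, h, Complex.exp_nat_mul, Complex.exp_neg,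
    Complex.exp_pi_div_two_mul_I, Complex.inv_I]

/-! ### Polynomial growth along the Fock states -/

/-- The seminorm `p` grows at most polynomially along the Fock states. -/
def FockPolyBounded (p : Seminorm ℂ 𝓢(ℝ, ℂ)) : Prop :=
  ∃ (C : ℝ) (k : ℕ), ∀ n : ℕ, p (fockS n) ≤ C * (n + 1) ^ k

namespace FockPolyBounded

variable {p q : Seminorm ℂ 𝓢(ℝ, ℂ)}

theorem mono (hq : FockPolyBounded q) (h : p ≤ q) : FockPolyBounded p := by
  obtain ⟨C, k, hC⟩ := hq
  exact ⟨C, k, fun n => (h _).trans (hC n)⟩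

theorem add (hp : FockPolyBounded p) (hq : FockPolyBounded q) : FockPolyBounded (p + q) := by
  obtain ⟨C, k, hC⟩ := hp
  obtain ⟨D, l, hD⟩ := hq
  have hC0 : 0 ≤ C := by simpa using (apply_nonneg p _).trans (hC 0)
  have hD0 : 0 ≤ D := by simpa using (apply_nonneg q _).trans (hD 0)
  refine ⟨C + D, k + l, fun n => ?_⟩
  have h1 : (1 : ℝ) ≤ n + 1 := by linarith [Nat.cast_nonneg (α := ℝ) n]
  calc p (fockS n) + q (fockS n)
      ≤ C * (n + 1) ^ k + D * (n + 1) ^ l := add_le_add (hC n) (hD n)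
    _ ≤ C * (n + 1) ^ (k + l) + D * (n + 1) ^ (k + l) := by
        gcongr <;> first | exact h1 | omega
    _ = (C + D) * (n + 1) ^ (k + l) := by ring

theorem smul (c : NNReal) (hp : FockPolyBounded p) : FockPolyBounded (c • p) := by
  obtain ⟨C, k, hC⟩ := hp
  refine ⟨c * C, k, fun n => ?_⟩
  rw [smul_apply, NNReal.smul_def, smul_eq_mul, mul_assoc]
  exact mul_le_mul_of_nonneg_left (hC n) c.2

theorem finset_sup {ι : Type*} {p : ι → Seminorm ℂ 𝓢(ℝ, ℂ)} (h : ∀ i, FockPolyBounded (p i))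
    (s : Finset ι) : FockPolyBounded (s.sup p) := by
  classical
  induction s using Finset.induction_on with
  | empty => exact ⟨0, 0, fun n => by simp⟩
  | insert i s _ ih =>
    rw [Finset.sup_insert]
    refine ((h i).add ih).mono fun u => ?_
    exact max_le (le_add_of_nonneg_right (apply_nonneg _ _))
      (le_add_of_nonneg_left (apply_nonneg _ _))

theorem comp_creation (hp : FockPolyBounded p) :
    FockPolyBounded (p.comp (creation : 𝓢(ℝ, ℂ) →ₗ[ℂ] 𝓢(ℝ, ℂ))) := by
  obtain ⟨C, k, hC⟩ := hp
  have hC0 : 0 ≤ C := by simpa using (apply_nonneg p _).trans (hC 0)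
  refine ⟨C * 2 ^ k, k + 1, fun n => ?_⟩
  have hsqrt : √((n : ℝ) + 1) ≤ n + 1 :=
    Real.sqrt_le_iff.2 ⟨by positivity, by nlinarith [Nat.cast_nonneg (α := ℝ) n]⟩
  calc p (creation (fockS n)) = √(n + 1) * p (fockS (n + 1)) := by
        rw [creation_fockS, map_smul_eq_mul, Complex.norm_real,
          Real.norm_of_nonneg (Real.sqrt_nonneg _)]
    _ ≤ (n + 1) * (C * (2 * (n + 1)) ^ k) := by
        gcongr
        refine (hC (n + 1)).trans ?_
        push_cast
        gcongr
        linarith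
    _ = C * 2 ^ k * (n + 1) ^ (k + 1) := by
        rw [mul_pow]
        ring

theorem comp_annihilation (hp : FockPolyBounded p) :
    FockPolyBounded (p.comp (annihilation : 𝓢(ℝ, ℂ) →ₗ[ℂ] 𝓢(ℝ, ℂ))) := by
  obtain ⟨C, k, hC⟩ := hp
  have hC0 : 0 ≤ C := by simpa using (apply_nonneg p _).trans (hC 0)
  refine ⟨C, k + 1, fun n => ?_⟩
  cases n with
  | zero =>
    rw [Seminorm.comp_apply, ContinuousLinearMap.coe_coe, fockS, annihilation_vacuum, map_zero]
    positivity
  | succ n =>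
    have hsqrt : √((n : ℝ) + 1) ≤ n + 1 :=
      Real.sqrt_le_iff.2 ⟨by positivity, by nlinarith [Nat.cast_nonneg (α := ℝ) n]⟩
    calc p (annihilation (fockS (n + 1))) = √(n + 1) * p (fockS n) := by
          rw [annihilation_fockS_succ, map_smul_eq_mul, Complex.norm_real,
            Real.norm_of_nonneg (Real.sqrt_nonneg _)]
      _ ≤ (n + 1) * (C * (n + 1) ^ k) := by
          gcongr
          exact hC n
      _ = C * (n + 1) ^ (k + 1) := by ring
      _ ≤ C * ((n + 1 : ℕ) + 1) ^ (k + 1) := by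
          push_cast
          gcongr
          linarith

theorem comp_position (hp : FockPolyBounded p) :
    FockPolyBounded (p.comp (position : 𝓢(ℝ, ℂ) →ₗ[ℂ] 𝓢(ℝ, ℂ))) := by
  refine ((hp.comp_annihilation.add hp.comp_creation).smul ‖((√2 : ℝ) : ℂ)⁻¹‖₊).mono fun u => ?_
  rw [Seminorm.comp_apply, ContinuousLinearMap.coe_coe, position_eq_ladder, smul_apply,
    map_smul_eq_mul]
  exact mul_le_mul_of_nonneg_left (map_add_le_add p _ _) (norm_nonneg _)

theorem comp_derivCLM (hp : FockPolyBounded p) :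
    FockPolyBounded (p.comp (derivCLM ℂ ℂ : 𝓢(ℝ, ℂ) →ₗ[ℂ] 𝓢(ℝ, ℂ))) := by
  refine ((hp.comp_annihilation.add hp.comp_creation).smul ‖((√2 : ℝ) : ℂ)⁻¹‖₊).mono fun u => ?_
  rw [Seminorm.comp_apply, ContinuousLinearMap.coe_coe, derivCLM_eq_ladder, smul_apply,
    map_smul_eq_mul]
  exact mul_le_mul_of_nonneg_left (map_sub_le_add p _ _) (norm_nonneg _)

end FockPolyBounded

/-- The `L²` norm of Schwartz functions. -/
def seminormL2 : Seminorm ℂ 𝓢(ℝ, ℂ) :=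
  (normSeminorm ℂ L2).comp (toLpCLM ℂ ℂ 2 (volume : Measure ℝ) : 𝓢(ℝ, ℂ) →ₗ[ℂ] L2)

theorem fockPolyBounded_seminormL2 : FockPolyBounded seminormL2 :=
  ⟨1, 0, fun n => by
    rw [pow_zero, mul_one]
    exact (orthonormal_fock.1 n).le⟩

theorem seminormL2_sq (g : 𝓢(ℝ, ℂ)) : seminormL2 g ^ 2 = ∫ x, ‖g x‖ ^ 2 := by
  have h : seminormL2 g = √(∫ x, ‖g x‖ ^ 2) := by
    refine (norm_toLp' (by norm_num) (by norm_num)).trans ?_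
    simp [Real.sqrt_eq_rpow]
  rw [h, Real.sq_sqrt (integral_nonneg fun x => by positivity)]

theorem integrable_norm_sq (g : 𝓢(ℝ, ℂ)) : Integrable fun x => ‖g x‖ ^ 2 :=
  (memLp_two_iff_integrable_sq_norm g.continuous.aestronglyMeasurable).1 (g.memLp 2 volume)

theorem norm_sq_apply_le (g : 𝓢(ℝ, ℂ)) (x : ℝ) :
    ‖g x‖ ^ 2 ≤ seminormL2 g ^ 2 + seminormL2 (derivCLM ℂ ℂ g) ^ 2 := by
  have hderiv : ∀ y, HasDerivAt (fun y => ‖g y‖ ^ 2) (2 * ⟪g y, derivCLM ℂ ℂ g y⟫_ℝ) y :=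
    fun y => (g.hasDerivAt y).norm_sq
  have hbound : ∀ y, ‖2 * ⟪g y, derivCLM ℂ ℂ g y⟫_ℝ‖ ≤ ‖g y‖ ^ 2 + ‖derivCLM ℂ ℂ g y‖ ^ 2 := by
    intro y
    rw [norm_mul, Real.norm_two]
    nlinarith [sq_nonneg (‖g y‖ - ‖derivCLM ℂ ℂ g y‖),
      norm_inner_le_norm (𝕜 := ℝ) (g y) (derivCLM ℂ ℂ g y)]
  have hint := (integrable_norm_sq g).add (integrable_norm_sq (derivCLM ℂ ℂ g))
  have hint' : Integrable fun y => 2 * ⟪g y, derivCLM ℂ ℂ g y⟫_ℝ := by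
    refine hint.mono' ?_ (Eventually.of_forall hbound)
    have := g.continuous
    have := (derivCLM ℂ ℂ g).continuous
    exact Continuous.aestronglyMeasurable (by fun_prop)
  have hlim : Tendsto (fun y => ‖g y‖ ^ 2) atBot (𝓝 0) := by
    simpa using (g.tendsto_cocompact.mono_left _root_.atBot_le_cocompact).norm.pow 2
  calc ‖g x‖ ^ 2 = ∫ y in Set.Iic x, 2 * ⟪g y, derivCLM ℂ ℂ g y⟫_ℝ := by
        rw [integral_Iic_of_hasDerivAt_of_tendsto' (fun y _ => hderiv y) hint'.integrableOn hlim,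
          sub_zero]
    _ ≤ ∫ y in Set.Iic x, (‖g y‖ ^ 2 + ‖derivCLM ℂ ℂ g y‖ ^ 2) :=
        setIntegral_mono hint'.integrableOn hint.integrableOn
          fun y => (le_abs_self _).trans (hbound y)
    _ ≤ ∫ y, (‖g y‖ ^ 2 + ‖derivCLM ℂ ℂ g y‖ ^ 2) :=
        setIntegral_le_integral hint (Eventually.of_forall fun y => by positivity)
    _ = seminormL2 g ^ 2 + seminormL2 (derivCLM ℂ ℂ g) ^ 2 := by
        rw [integral_add (integrable_norm_sq g) (integrable_norm_sq _), seminormL2_sq,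
          seminormL2_sq]

theorem norm_apply_le_seminormL2 (g : 𝓢(ℝ, ℂ)) (x : ℝ) :
    ‖g x‖ ≤ seminormL2 g + seminormL2 (derivCLM ℂ ℂ g) := by
  have h0 := apply_nonneg seminormL2 g
  have h1 := apply_nonneg seminormL2 (derivCLM ℂ ℂ g)
  refine (sq_le_sq₀ (norm_nonneg _) (by positivity)).1 ((norm_sq_apply_le g x).trans ?_)
  nlinarith [mul_nonneg h0 h1]

theorem position_pow_apply (k : ℕ) (u : 𝓢(ℝ, ℂ)) (x : ℝ) :
    (position ^ k) u x = x ^ k * u x := by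
  induction k generalizing u with
  | zero => rw [pow_zero, pow_zero, one_mul, one_apply_eq_self]
  | succ k ih =>
    rw [pow_succ', mul_apply_eq_comp, position_apply, ih, pow_succ', mul_assoc]

theorem derivCLM_pow_apply (m : ℕ) (u : 𝓢(ℝ, ℂ)) (x : ℝ) :
    (derivCLM ℂ ℂ ^ m) u x = iteratedDeriv m u x := by
  induction m generalizing x with
  | zero => rw [pow_zero, iteratedDeriv_zero, one_apply_eq_self]
  | succ m ih =>
    rw [pow_succ', mul_apply_eq_comp, derivCLM_apply, iteratedDeriv_succ]
    exact congrArg (fun f => deriv f x) (funext ih)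

theorem FockPolyBounded.comp_pow {p : Seminorm ℂ 𝓢(ℝ, ℂ)} (hp : FockPolyBounded p)
    {T : 𝓢(ℝ, ℂ) →L[ℂ] 𝓢(ℝ, ℂ)}
    (hT : ∀ q, FockPolyBounded q → FockPolyBounded (q.comp (T : 𝓢(ℝ, ℂ) →ₗ[ℂ] 𝓢(ℝ, ℂ))))
    (k : ℕ) : FockPolyBounded (p.comp ((T ^ k : 𝓢(ℝ, ℂ) →L[ℂ] 𝓢(ℝ, ℂ)) :
      𝓢(ℝ, ℂ) →ₗ[ℂ] 𝓢(ℝ, ℂ))) := by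
  induction k with
  | zero => exact hp
  | succ k ih => exact hT _ ih

theorem fockPolyBounded_seminorm (k m : ℕ) : FockPolyBounded (SchwartzMap.seminorm ℂ k m) := by
  have hcomp : ∀ p, FockPolyBounded p → FockPolyBounded
      ((p.comp ((position ^ k : 𝓢(ℝ, ℂ) →L[ℂ] 𝓢(ℝ, ℂ)) : 𝓢(ℝ, ℂ) →ₗ[ℂ] 𝓢(ℝ, ℂ))).comp
        ((derivCLM ℂ ℂ ^ m : 𝓢(ℝ, ℂ) →L[ℂ] 𝓢(ℝ, ℂ)) : 𝓢(ℝ, ℂ) →ₗ[ℂ] 𝓢(ℝ, ℂ))) := fun p hp =>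
    (hp.comp_pow (fun _ => FockPolyBounded.comp_position) k).comp_pow
      (fun _ => FockPolyBounded.comp_derivCLM) m
  refine ((hcomp _ fockPolyBounded_seminormL2).add
    (hcomp _ fockPolyBounded_seminormL2.comp_derivCLM)).mono fun u => ?_
  refine seminorm_le_bound' ℂ k m u (apply_nonneg _ _) fun x => ?_
  refine le_trans (le_of_eq ?_)
    (norm_apply_le_seminormL2 ((position ^ k) ((derivCLM ℂ ℂ ^ m) u)) x)
  rw [position_pow_apply, derivCLM_pow_apply, norm_mul, norm_pow, Complex.norm_real,
    Real.norm_eq_abs]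

theorem fockPolyBounded_of_continuous {p : Seminorm ℂ 𝓢(ℝ, ℂ)} (hp : Continuous p) :
    FockPolyBounded p := by
  obtain ⟨s, C, -, hle⟩ := Seminorm.bound_of_continuous (schwartz_withSeminorms ℂ ℝ ℂ) p hp
  have hs : FockPolyBounded (s.sup (schwartzSeminormFamily ℂ ℝ ℂ)) :=
    .finset_sup (fun i : ℕ × ℕ => fockPolyBounded_seminorm i.1 i.2) s
  exact (hs.smul C).mono hle

theorem exists_norm_apply_fockS_le (T : 𝓢'(ℝ, ℂ)) :
    ∃ (C : ℝ) (k : ℕ), ∀ n : ℕ, ‖T (fockS n)‖ ≤ C * (n + 1) ^ k :=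
  fockPolyBounded_of_continuous (p := (normSeminorm ℂ ℂ).comp (T : 𝓢(ℝ, ℂ) →ₗ[ℂ] ℂ))
    (T.continuous.norm)

theorem summable_exp_smul_fock (T : 𝓢'(ℝ, ℂ)) {β : ℝ} (hβ : 0 < β) :
    Summable fun n : ℕ =>
      (((Real.exp (-β * (n + 1 / 2)) : ℝ) : ℂ) * T (fockS n)) • fock n := by
  obtain ⟨C, k, hC⟩ := exists_norm_apply_fockS_le T
  have hs := (summable_nat_add_iff 1).2 (Real.summable_pow_mul_exp_neg_nat_mul k hβ)
  refine .of_norm_bounded (hs.mul_left (Real.exp (β / 2) * C)) fun n => ?_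
  have hexp : Real.exp (-β * (n + 1 / 2)) =
      Real.exp (β / 2) * Real.exp (-β * ((n + 1 : ℕ) : ℝ)) := by
    rw [← Real.exp_add]
    push_cast
    ring_nf
  rw [norm_smul, orthonormal_fock.1 n, mul_one, norm_mul, Complex.norm_real, Real.norm_eq_abs,
    Real.abs_exp]
  calc Real.exp (-β * (n + 1 / 2)) * ‖T (fockS n)‖
      ≤ Real.exp (-β * (n + 1 / 2)) * (C * (n + 1) ^ k) := by
        gcongr
        exact hC n
    _ = _ := by
        rw [hexp]
        push_cast
        ring

/-! ### Completeness of the Fock states -/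

theorem ae_eq_zero_of_fourier_eq_zero {V : Type*} [NormedAddCommGroup V] [InnerProductSpace ℝ V]
    [FiniteDimensional ℝ V] [MeasurableSpace V] [BorelSpace V] {h : V → ℂ} (hint : Integrable h)
    (hF : 𝓕 h = 0) : h =ᵐ[volume] 0 := by
  have hpair : ∀ ψ : 𝓢(V, ℂ), ∫ x, h x * ψ x = 0 := fun ψ => by
    have hflip := VectorFourier.integral_bilin_fourierIntegral_eq_flip
      (ContinuousLinearMap.mul ℂ ℂ) (L := innerₗ V) (μ := volume) (ν := volume)
      Real.continuous_fourierChar continuous_inner hint (𝓕⁻ ψ : 𝓢(V, ℂ)).integrable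
    have hh : VectorFourier.fourierIntegral Real.fourierChar volume (innerₗ V) h = 0 := hF
    have hψ : VectorFourier.fourierIntegral Real.fourierChar volume (innerₗ V).flip
        (𝓕⁻ ψ : 𝓢(V, ℂ)) = ψ := by
      rw [flip_innerₗ]
      change 𝓕 ((𝓕⁻ ψ : 𝓢(V, ℂ)) : V → ℂ) = ψ
      rw [← fourier_coe, FourierTransform.fourier_fourierInv_eq]
    rw [hh, hψ] at hflip
    simpa using hflip.symm
  refine ae_eq_zero_of_integral_contDiff_smul_eq_zero hint.locallyIntegrable fun g hg hgc => ?_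
  have hgc' : HasCompactSupport (Complex.ofRealCLM ∘ g) := hgc.comp_left rfl
  have hg' : ContDiff ℝ ∞ (Complex.ofRealCLM ∘ g) := by fun_prop
  rw [← hpair (hgc'.toSchwartzMap hg')]
  refine integral_congr_ae (Eventually.of_forall fun x => ?_)
  simp [mul_comm]

section Moments

variable {h : ℝ → ℂ} {μ : Measure ℝ}

theorem integral_exp_mul_eq_zero_of_moments
    (hexp : ∀ c : ℝ, Integrable (fun x => Real.exp (c * |x|) • h x) μ)
    (hmom : ∀ m : ℕ, ∫ x, (x : ℂ) ^ m * h x ∂μ = 0) (c : ℂ) :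
    ∫ x, Complex.exp (c * x) * h x ∂μ = 0 := by
  have hmeas : AEStronglyMeasurable h μ := by simpa using (hexp 0).1
  have hterm : ∀ m : ℕ, ∫ x, (c * x) ^ m / m ! * h x ∂μ = 0 := fun m => by
    have h_eq : ∀ x : ℝ, (c * x) ^ m / m ! * h x = c ^ m / m ! * ((x : ℂ) ^ m * h x) := fun x => by
      ring
    simp only [h_eq, integral_const_mul, hmom, mul_zero]
  have hsum := hasSum_integral_of_dominated_convergence (μ := μ)
    (F := fun (m : ℕ) (x : ℝ) => (c * x) ^ m / m ! * h x)
    (f := fun x : ℝ => Complex.exp (c * x) * h x)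
    (fun m x => (‖c‖ * |x|) ^ m / m ! * ‖h x‖)
    (fun m => AEStronglyMeasurable.mul (Continuous.aestronglyMeasurable (by fun_prop)) hmeas)
    (fun m => Eventually.of_forall fun x => by
      rw [norm_mul, norm_div, norm_pow, norm_mul, Complex.norm_real, Complex.norm_natCast,
        Real.norm_eq_abs])
    (Eventually.of_forall fun x => (Real.summable_pow_div_factorial _).mul_right _)
    (by
      refine (hexp ‖c‖).norm.congr (Eventually.of_forall fun x => ?_)
      simp only
      rw [tsum_mul_right, norm_smul, Real.norm_eq_abs, Real.abs_exp, Real.exp_eq_exp_ℝ,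
        NormedSpace.exp_eq_tsum_div])
    (Eventually.of_forall fun x => by
      refine HasSum.mul_right _ ?_
      rw [Complex.exp_eq_exp_ℂ]
      exact NormedSpace.expSeries_div_hasSum_exp _)
  simp only [hterm] at hsum
  exact hsum.unique hasSum_zero

theorem ae_eq_zero_of_moments (hexp : ∀ c : ℝ, Integrable fun x => Real.exp (c * |x|) • h x)
    (hmom : ∀ m : ℕ, ∫ x : ℝ, (x : ℂ) ^ m * h x = 0) : h =ᵐ[volume] 0 := by
  refine ae_eq_zero_of_fourier_eq_zero (by simpa using hexp 0) (funext fun w => ?_)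
  rw [Pi.zero_apply, Real.fourier_real_eq_integral_exp_smul,
    ← integral_exp_mul_eq_zero_of_moments hexp hmom (-2 * π * w * Complex.I)]
  congr 1 with x
  rw [smul_eq_mul]
  congr 2
  push_cast
  ring

end Moments

theorem position_pow_fockS_eq_zero {T : 𝓢'(ℝ, ℂ)} (hT : ∀ n, T (fockS n) = 0) (m n : ℕ) :
    T ((position ^ m) (fockS n)) = 0 := by
  induction m generalizing n with
  | zero => exact hT n
  | succ m ih =>
    have hann : T ((position ^ m) (annihilation (fockS n))) = 0 := by
      cases n with
      | zero => rw [fockS, annihilation_vacuum, map_zero, map_zero]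
      | succ n => rw [annihilation_fockS_succ, map_smul, map_smul, ih, smul_zero]
    have hcre : T ((position ^ m) (creation (fockS n))) = 0 := by
      rw [creation_fockS, map_smul, map_smul, ih, smul_zero]
    have hladder : position (fockS n) =
        ((√2 : ℝ) : ℂ)⁻¹ • (annihilation (fockS n) + creation (fockS n)) := by
      rw [position_eq_ladder]
      rfl
    rw [pow_succ, mul_apply_eq_comp, hladder, map_smul, map_smul, map_add, map_add, hann, hcre,
      add_zero, smul_zero]

theorem integrable_exp_smul_vacuum_mul (f : L2) (c : ℝ) :
    Integrable fun x : ℝ => Real.exp (c * |x|) • (vacuum x * f x) := by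
  have hcont : Continuous fun x : ℝ => Real.exp (c * |x|) • vacuum x := by
    have := vacuum.continuous
    fun_prop
  have hmem : MemLp (fun x : ℝ => Real.exp (c * |x|) • vacuum x) 2 := by
    rw [memLp_two_iff_integrable_sq_norm hcont.aestronglyMeasurable]
    refine ((integrable_exp_neg_mul_sq (b := 1 / 2) (by norm_num)).const_mul
      ((π ^ (-(1 / 4) : ℝ)) ^ 2 * Real.exp (2 * c ^ 2))).mono'
      (hcont.norm.pow 2).aestronglyMeasurable (Eventually.of_forall fun x => ?_)
    rw [norm_pow, norm_norm, norm_smul, vacuum_apply, Complex.norm_real,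
      Real.norm_of_nonneg (by positivity), Real.norm_of_nonneg (by positivity), mul_pow, mul_pow,
      ← Real.exp_nat_mul, ← Real.exp_nat_mul, mul_left_comm, mul_assoc, ← Real.exp_add,
      ← Real.exp_add]
    refine mul_le_mul_of_nonneg_left (Real.exp_le_exp.2 ?_) (by positivity)
    push_cast
    nlinarith [sq_nonneg (|x| - 2 * c), sq_abs x]
  refine (hmem.integrable_mul (Lp.memLp f)).congr (Eventually.of_forall fun x => ?_)
  exact smul_mul_assoc _ _ _

theorem eq_zero_of_inner_fock {f : L2} (hf : ∀ n, ⟪fock n, f⟫_ℂ = 0) : f = 0 := by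
  have hmom : ∀ m : ℕ, ∫ x : ℝ, (x : ℂ) ^ m * (vacuum x * f x) = 0 := fun m => by
    have hT := position_pow_fockS_eq_zero (T := (f : 𝓢'(ℝ, ℂ)))
      (fun n => (toTemperedDistribution_fockS f n).trans (hf n)) m 0
    rw [Lp.toTemperedDistribution_apply] at hT
    simpa only [position_pow_apply, fockS, smul_eq_mul, mul_assoc] using hT
  rw [Lp.eq_zero_iff_ae_eq_zero]
  filter_upwards [ae_eq_zero_of_moments (integrable_exp_smul_vacuum_mul f) hmom] with x hx
  refine (mul_eq_zero.1 hx).resolve_left ?_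
  rw [vacuum_apply, Complex.ofReal_eq_zero]
  positivity

theorem ext_inner_fock {f g : L2} (h : ∀ n, ⟪fock n, f⟫_ℂ = ⟪fock n, g⟫_ℂ) : f = g :=
  sub_eq_zero.1 (eq_zero_of_inner_fock fun n => by rw [inner_sub_right, h, sub_self])

theorem inner_fock_of_hasSum {c : ℕ → ℂ} {f : L2} (h : HasSum (fun n => c n • fock n) f) (n : ℕ) :
    ⟪fock n, f⟫_ℂ = c n := by
  have hsum := h.mapL (innerSL ℂ (fock n))
  simp only [innerSL_apply_apply, inner_smul_right,
    orthonormal_iff_ite.1 orthonormal_fock, mul_ite, mul_one, mul_zero] at hsum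
  simpa using hsum.unique (hasSum_single n fun m hm => if_neg hm.symm)

/-! ### The Fourier operator -/

theorem inner_fock_fourierOp (f : L2) (n : ℕ) :
    ⟪fock n, fourierOp f⟫_ℂ = Complex.exp (π * Complex.I * n / 2) * ⟪fock n, f⟫_ℂ :=
  inner_fock_of_hasSum (summable_phase f).hasSum n

theorem fourierOp_fock (n : ℕ) :
    fourierOp (fock n) = Complex.exp (π * Complex.I * n / 2) • fock n := by
  refine ext_inner_fock fun m => ?_
  rw [inner_fock_fourierOp, inner_smul_right, orthonormal_iff_ite.1 orthonormal_fock]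
  split_ifs with h
  · rw [h]
  · rw [mul_zero, mul_zero]

theorem inner_fock_adjoint_fourierOp (f : L2) (n : ℕ) :
    ⟪fock n, ContinuousLinearMap.adjoint fourierOp f⟫_ℂ = (-Complex.I) ^ n * ⟪fock n, f⟫_ℂ := by
  rw [ContinuousLinearMap.adjoint_inner_right, fourierOp_fock, inner_smul_left, conj_phase]

theorem fourierOp_adjoint_fourierOp (f : L2) :
    fourierOp (ContinuousLinearMap.adjoint fourierOp f) = f :=
  ext_inner_fock fun n => by
    rw [inner_fock_fourierOp, inner_fock_adjoint_fourierOp, ← conj_phase, ← mul_assoc,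
      Complex.mul_conj', norm_phase, Complex.ofReal_one, one_pow, one_mul]

/-! ### Dirac combs and Poisson summation -/

theorem alpha_pos {d : ℕ} (hd : 0 < d) : 0 < alpha d :=
  Real.sqrt_pos.2 (by positivity)

theorem alpha_mul_self_mul {d : ℕ} (hd : 0 < d) : alpha d * alpha d * d = 2 * π := by
  rw [alpha, Real.mul_self_sqrt (by positivity)]
  field_simp

/-- The Dirac comb with teeth at the points of `T ℤ + b`. -/
def diracComb (T b : ℝ) : Measure ℝ :=
  Measure.sum fun s : ℤ => Measure.dirac (T * s + b)

theorem summable_one_add_abs_rpow_neg_two {T : ℝ} (hT : T ≠ 0) (b : ℝ) :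
    Summable fun s : ℤ => (1 + |T * s + b|) ^ (-2 : ℝ) := by
  have hfin : {s : ℤ | (s : ℝ) + b / T = 0}.Finite :=
    Set.Subsingleton.finite fun s hs t ht => by
      exact_mod_cast add_right_cancel (Eq.trans hs (Eq.symm ht))
  refine Summable.of_norm_bounded_eventually
    (((Real.summable_one_div_int_add_rpow (b / T) 2).2 one_lt_two).mul_left (|T| ^ (-2 : ℝ))) ?_
  filter_upwards [hfin.compl_mem_cofinite] with s hs
  have hpos : 0 < |(s : ℝ) + b / T| := abs_pos.2 hs
  rw [Real.norm_of_nonneg (by positivity), one_div, ← Real.rpow_neg hpos.le,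
    ← Real.mul_rpow (abs_nonneg _) hpos.le, ← abs_mul, mul_add, mul_div_cancel₀ _ hT]
  refine Real.rpow_le_rpow_of_nonpos ?_ (by linarith) (by norm_num)
  rw [← mul_div_cancel₀ b hT, ← mul_add, abs_mul]
  positivity

theorem hasTemperateGrowth_diracComb {T : ℝ} (hT : T ≠ 0) (b : ℝ) :
    (diracComb T b).HasTemperateGrowth := by
  have h := integrable_sum_dirac (c := fun _ : ℤ => 1) (x := fun s : ℤ => T * (s : ℝ) + b)
    (f := fun x : ℝ => (1 + ‖x‖) ^ (-((2 : ℕ) : ℝ)))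
    (by simp) (by simpa using summable_one_add_abs_rpow_neg_two hT b)
  exact ⟨2, by simpa only [diracComb, one_smul] using h⟩

theorem hasSum_integral_diracComb {T : ℝ} (hT : T ≠ 0) (b : ℝ) (u : 𝓢(ℝ, ℂ)) :
    HasSum (fun s : ℤ => u (T * s + b)) (∫ y, u y ∂diracComb T b) := by
  have := hasTemperateGrowth_diracComb hT b
  simpa only [diracComb, integral_dirac] using
    hasSum_integral_measure (u.integrable (μ := diracComb T b))

theorem hasSum_delta_diracComb {T : ℝ} (hT : T ≠ 0) (b : ℝ)
    [(diracComb T b).HasTemperateGrowth] :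
    HasSum (fun s : ℤ => (TemperedDistribution.delta (T * s + b) : 𝓢'(ℝ, ℂ)))
      (diracComb T b).toTemperedDistribution := by
  refine PointwiseConvergenceCLM.tendsto_iff_forall_tendsto.2 fun u => ?_
  refine (hasSum_integral_diracComb hT b u).congr fun t => ?_
  simp

theorem map_add_diracComb (T b : ℝ) : (diracComb T b).map (· + T) = diracComb T b := by
  have hadd : Measurable (· + T) := by fun_prop
  conv_rhs => rw [diracComb, ← Measure.sum_comp_equiv (Equiv.addRight (1 : ℤ))]
  rw [diracComb, Measure.map_sum hadd.aemeasurable]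
  congr with s : 1
  rw [Measure.map_dirac' hadd, Function.comp_apply, Equiv.coe_addRight]
  congr 1
  push_cast
  ring

theorem diracComb_ne_zero (T b : ℝ) : diracComb T b ≠ 0 := fun h =>
  Measure.dirac_ne_zero (Measure.sum_eq_zero.1 h 0)

theorem fourier_comp_mul {T : ℝ} (hT : 0 < T) (f : ℝ → ℂ) (w : ℝ) :
    𝓕 (fun x => f (T * x)) w = (T : ℂ)⁻¹ * 𝓕 f (w / T) := by
  rw [Real.fourier_real_eq_integral_exp_smul, Real.fourier_real_eq_integral_exp_smul]
  have h := Measure.integral_comp_mul_left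
    (fun x : ℝ => Complex.exp ((-2 * π * x * (w / T) : ℝ) * Complex.I) • f x) T
  rw [abs_of_pos (inv_pos.2 hT), Complex.real_smul, Complex.ofReal_inv] at h
  rw [← h]
  congr with x
  congr 4
  field_simp

theorem fourier_fourier_apply (u : 𝓢(ℝ, ℂ)) (x : ℝ) : 𝓕 (𝓕 u) x = u (-x) := by
  rw [← congrArg (· (-x)) (FourierTransform.fourierInv_fourier_eq (F := 𝓢(ℝ, ℂ)) u),
    fourierInv_apply_eq]
  simp

theorem tsum_fourier_add (u : 𝓢(ℝ, ℂ)) (x : ℝ) :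
    ∑' s : ℤ, 𝓕 (u : ℝ → ℂ) (x + s) =
      ∑' m : ℤ, Complex.exp (-(2 * π * Complex.I * m * x)) * u m := by
  have h := SchwartzMap.tsum_eq_tsum_fourier (𝓕 u) x
  rw [fourier_coe] at h
  rw [h, ← (Equiv.neg ℤ).tsum_eq]
  refine tsum_congr fun m => ?_
  rw [fourier_fourier_apply, fourier_coe_apply, mul_comm]
  simp

theorem tsum_fourierU {T : ℝ} (hT : 0 < T) (b : ℝ) (u : 𝓢(ℝ, ℂ)) :
    ∑' s : ℤ, fourierU u (T * s + b) =
      (√(2 * π) / T : ℝ) * ∑' m : ℤ, Complex.exp (-(2 * π * Complex.I * m * (b / T))) *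
        u (2 * π / T * m) := by
  have hc : 0 < 2 * π / T := by positivity
  have hdil : (compCLMOfContinuousLinearEquiv ℂ (dilation _ hc.ne') u : ℝ → ℂ) =
      fun x => u (2 * π / T * x) :=
    funext fun x => congrArg u (dilation_apply hc.ne' x)
  have hu : ∀ s : ℤ, fourierU u (T * s + b) =
      (√(2 * π) / T : ℝ) *
        𝓕 (compCLMOfContinuousLinearEquiv ℂ (dilation _ hc.ne') u : ℝ → ℂ) (b / T + s) := by
    intro s
    have harg : (b / T + s) / (2 * π / T) = (T * s + b) * (2 * π)⁻¹ := by field_simp; ring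
    have hconst : (√(2 * π))⁻¹ = √(2 * π) / T * (2 * π / T)⁻¹ := by
      field_simp
      exact (Real.sq_sqrt Real.two_pi_pos.le).symm
    rw [fourierU_apply_eq_fourier, hdil, fourier_comp_mul hc, harg,
      ← mul_assoc, fourier_coe]
    congr 1
    exact_mod_cast hconst
  simp only [hu]
  rw [tsum_mul_left, tsum_fourier_add]
  simp only [hdil]
  push_cast
  rfl

/-- The Dirac comb of which the ideal code state `idealState d j` is a multiple. -/
def codeComb (d : ℕ) (j : Fin d) : Measure ℝ :=
  diracComb (alpha d * d) (alpha d * (j : ℕ))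

theorem codeComb_period_pos {d : ℕ} (j : Fin d) : 0 < alpha d * d :=
  mul_pos (alpha_pos j.pos) (Nat.cast_pos.2 j.pos)

instance (d : ℕ) (j : Fin d) : (codeComb d j).HasTemperateGrowth :=
  hasTemperateGrowth_diracComb (codeComb_period_pos j).ne' _

instance (d : ℕ) (j : Fin d) : SFinite (codeComb d j) :=
  inferInstanceAs (SFinite (Measure.sum _))

instance (d : ℕ) (j : Fin d) : NeZero (codeComb d j) :=
  ⟨diracComb_ne_zero _ _⟩

theorem idealState_eq_smul_toTemperedDistribution {d : ℕ} (j : Fin d) :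
    idealState d j = ((√(alpha d * d) : ℝ) : ℂ) • (codeComb d j).toTemperedDistribution := by
  have : (diracComb (alpha d * d) (alpha d * (j : ℕ))).HasTemperateGrowth :=
    inferInstanceAs (codeComb d j).HasTemperateGrowth
  simp only [idealState, mul_add, ← mul_assoc]
  rw [(hasSum_delta_diracComb (codeComb_period_pos j).ne' (alpha d * (j : ℕ))).tsum_eq]
  rfl

theorem idealState_apply {d : ℕ} (j : Fin d) (u : 𝓢(ℝ, ℂ)) :
    idealState d j u = ((√(alpha d * d) : ℝ) : ℂ) * ∫ y, u y ∂codeComb d j := by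
  rw [idealState_eq_smul_toTemperedDistribution]
  rfl

theorem tsum_eq_sum_tsum_residue {d : ℕ} [NeZero d] {F : ℤ → ℂ} (hF : Summable F) :
    ∑' m, F m = ∑ k : Fin d, ∑' s : ℤ, F (s * d + (k : ℕ)) := by
  let e : Fin d × ℤ ≃ ℤ := (Equiv.prodComm _ _).trans (Int.divModEquiv d).symm
  have he : ∀ p, e p = p.2 * d + (p.1 : ℕ) := fun p => rfl
  have hFe : Summable fun p => F (e p) := e.summable_iff.2 hF
  rw [← e.tsum_eq F, hFe.tsum_prod, tsum_fintype]
  simp only [he]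

theorem summable_norm_comp_affine {T : ℝ} (hT : T ≠ 0) (b : ℝ) (u : 𝓢(ℝ, ℂ)) :
    Summable fun s : ℤ => ‖u (T * s + b)‖ := by
  have := hasTemperateGrowth_diracComb hT b
  simpa only [integral_dirac, norm_norm] using
    (u.integrable (μ := diracComb T b)).norm.summable_integral

theorem dft_phase_add_mul {d : ℕ} (hd : d ≠ 0) (j k s : ℤ) :
    Complex.exp (-(2 * π * Complex.I * j * (s * d + k : ℤ) / d)) =
      Complex.exp (-(2 * π * Complex.I * j * k / d)) := by
  have hd' : (d : ℂ) ≠ 0 := Nat.cast_ne_zero.2 hd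
  rw [Complex.exp_eq_exp_iff_exists_int]
  refine ⟨-(j * s), ?_⟩
  push_cast
  field_simp
  ring

theorem tsum_dft_phase_mul {d : ℕ} (j : Fin d) (u : 𝓢(ℝ, ℂ)) :
    ∑' m : ℤ, Complex.exp (-(2 * π * Complex.I * (j : ℕ) * m / d)) * u (alpha d * m) =
      ∑ k : Fin d, Complex.exp (-(2 * π * Complex.I * (j : ℕ) * (k : ℕ) / d)) *
        ∫ y, u y ∂codeComb d k := by
  have : NeZero d := ⟨j.pos.ne'⟩
  have hphase : ∀ m : ℤ, ‖Complex.exp (-(2 * π * Complex.I * (j : ℕ) * m / d))‖ = 1 := fun m => by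
    rw [show (-(2 * π * Complex.I * (j : ℕ) * m / d) : ℂ) =
      ((-(2 * π * (j : ℕ) * m / d) : ℝ) : ℂ) * Complex.I by push_cast; ring]
    exact Complex.norm_exp_ofReal_mul_I _
  have hsum : Summable fun m : ℤ =>
      Complex.exp (-(2 * π * Complex.I * (j : ℕ) * m / d)) * u (alpha d * m) :=
    Summable.of_norm <| by
      simpa only [norm_mul, hphase, one_mul, add_zero] using
        summable_norm_comp_affine (alpha_pos j.pos).ne' 0 u
  rw [tsum_eq_sum_tsum_residue (d := d) hsum]
  refine Finset.sum_congr rfl fun k _ => ?_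
  rw [codeComb, ← (hasSum_integral_diracComb (codeComb_period_pos k).ne' _ u).tsum_eq,
    ← tsum_mul_left]
  refine tsum_congr fun s => ?_
  congr 1
  · exact_mod_cast dft_phase_add_mul j.pos.ne' (j : ℕ) (k : ℕ) s
  · congr 1
    push_cast
    ring

theorem idealState_fourierU {d : ℕ} (j : Fin d) (u : 𝓢(ℝ, ℂ)) :
    idealState d j (fourierU u) = ∑ k, dftCoeff d j k * idealState d k u := by
  have hd : (0 : ℝ) < d := Nat.cast_pos.2 j.pos
  have hα := alpha_pos j.pos
  have hαd := alpha_mul_self_mul j.pos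
  have hconst : √(2 * π) / (alpha d * d) = (√d)⁻¹ := by
    rw [← hαd, Real.sqrt_mul (by positivity), Real.sqrt_mul_self hα.le]
    field_simp
    exact Real.sq_sqrt hd.le
  have hdual : 2 * π / (alpha d * d) = alpha d := by
    rw [← hαd]
    field_simp
  have hPoisson := tsum_fourierU (codeComb_period_pos j) (alpha d * (j : ℕ)) u
  rw [hconst, hdual] at hPoisson
  rw [idealState_apply, codeComb,
    ← (hasSum_integral_diracComb (codeComb_period_pos j).ne' _ (fourierU u)).tsum_eq, hPoisson]
  have hphase : ∀ m : ℤ, (2 * π * Complex.I * m * (alpha d * (j : ℕ) / (alpha d * d : ℝ)) : ℂ) =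
      2 * π * Complex.I * (j : ℕ) * m / d := fun m => by
    have : (alpha d : ℂ) ≠ 0 := Complex.ofReal_ne_zero.2 hα.ne'
    push_cast
    field_simp
  simp only [Complex.ofReal_mul, Complex.ofReal_natCast] at hphase ⊢
  simp only [hphase]
  rw [tsum_dft_phase_mul, Finset.mul_sum, Finset.mul_sum]
  refine Finset.sum_congr rfl fun k _ => ?_
  rw [idealState_apply, dftCoeff]
  push_cast
  ring

/-! ### The damped code states -/

theorem map_normalized_eq_iff {E ι : Type*} [NormedAddCommGroup E] [NormedSpace ℂ E] [Fintype ι]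
    (A : E →ₗ[ℂ] E) {v : ι → E} (hv : ∀ k, v k ≠ 0) (c : ι → ℂ) (j : ι) :
    A ((((√(‖v j‖ ^ 2))⁻¹ : ℝ) : ℂ) • v j) =
        ∑ k, (c k * ((√(‖v k‖ ^ 2 / ‖v j‖ ^ 2) : ℝ) : ℂ)) • (((√(‖v k‖ ^ 2))⁻¹ : ℝ) : ℂ) • v k ↔
      A (v j) = ∑ k, c k • v k := by
  have hnorm : ∀ k, (‖v k‖ : ℂ) ≠ 0 := fun k => Complex.ofReal_ne_zero.2 (norm_ne_zero_iff.2 (hv k))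
  have hj : (‖v j‖ : ℂ)⁻¹ ≠ 0 := inv_ne_zero (hnorm j)
  have hterm : ∀ k, (c k * ((√(‖v k‖ ^ 2 / ‖v j‖ ^ 2) : ℝ) : ℂ)) •
      (((√(‖v k‖ ^ 2))⁻¹ : ℝ) : ℂ) • v k = (‖v j‖ : ℂ)⁻¹ • c k • v k := fun k => by
    rw [← div_pow, Real.sqrt_sq (by positivity), Real.sqrt_sq (norm_nonneg _), smul_smul, smul_smul]
    have := hnorm k
    congr 1
    push_cast
    field_simp
  simp only [hterm]
  rw [Real.sqrt_sq (norm_nonneg _), Complex.ofReal_inv, map_smul, ← Finset.smul_sum]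
  exact (smul_right_injective E hj).eq_iff

theorem map_eq_of_leftInverse {K E : Type*} [Field K] [AddCommGroup E] [Module K E]
    {A B : E →ₗ[K] E} (hBA : Function.LeftInverse B A) {S : Submodule K E} [FiniteDimensional K S]
    (hS : S.map A ≤ S) : S.map B = S := by
  have hA : S.map A = S := Submodule.eq_of_le_of_finrank_eq hS
    (Submodule.equivMapOfInjective A hBA.injective S).finrank_eq.symm
  have hBA' : B ∘ₗ A = LinearMap.id := LinearMap.ext hBA
  calc S.map B = (S.map A).map B := by rw [hA]
    _ = S := by rw [← Submodule.map_comp, hBA', Submodule.map_id]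

theorem sqrt_alpha_mul_ne_zero {d : ℕ} (j : Fin d) : ((√(alpha d * d) : ℝ) : ℂ) ≠ 0 :=
  Complex.ofReal_ne_zero.2 (Real.sqrt_pos.2 (codeComb_period_pos j)).ne'

theorem idealState_vacuum_ne_zero {d : ℕ} (j : Fin d) : idealState d j vacuum ≠ 0 := by
  have hpos : 0 < ∫ y, gaussianSchwartz y ∂codeComb d j :=
    integral_exp_pos gaussianSchwartz.integrable
  rw [idealState_apply]
  refine mul_ne_zero (sqrt_alpha_mul_ne_zero j) ?_
  simp only [vacuum_apply]
  rw [integral_complex_ofReal, integral_const_mul, Complex.ofReal_ne_zero]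
  exact (mul_pos (by positivity) hpos).ne'

theorem inner_fock_approx3Vec {d : ℕ} {β : ℝ} (hβ : 0 < β) (j : Fin d) (n : ℕ) :
    ⟪fock n, approx3Vec d β j⟫_ℂ =
      ((Real.exp (-β * (n + 1 / 2)) : ℝ) : ℂ) * idealState d j (fockS n) :=
  inner_fock_of_hasSum (summable_exp_smul_fock _ hβ).hasSum n

theorem approx3Vec_ne_zero {d : ℕ} {β : ℝ} (hβ : 0 < β) (j : Fin d) : approx3Vec d β j ≠ 0 := by
  intro h
  have h0 := inner_fock_approx3Vec hβ j 0
  rw [h, inner_zero_right] at h0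
  exact mul_ne_zero (Complex.ofReal_ne_zero.2 (Real.exp_ne_zero _)) (idealState_vacuum_ne_zero j)
    h0.symm

theorem neg_I_pow_mul_idealState_fockS {d : ℕ} (j : Fin d) (n : ℕ) :
    (-Complex.I) ^ n * idealState d j (fockS n) =
      ∑ k, dftCoeff d j k * idealState d k (fockS n) := by
  rw [← idealState_fourierU, fourierU_fockS, map_smul, smul_eq_mul]

theorem adjoint_fourierOp_approx3Vec {d : ℕ} {β : ℝ} (hβ : 0 < β) (j : Fin d) :
    ContinuousLinearMap.adjoint fourierOp (approx3Vec d β j) =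
      ∑ k, dftCoeff d j k • approx3Vec d β k := by
  refine ext_inner_fock fun n => ?_
  rw [inner_fock_adjoint_fourierOp, inner_sum]
  simp only [inner_smul_right, inner_fock_approx3Vec hβ]
  rw [mul_left_comm, neg_I_pow_mul_idealState_fockS, Finset.mul_sum]
  exact Finset.sum_congr rfl fun k _ => mul_left_comm _ _ _

theorem adjoint_fourierOp_ket3 {d : ℕ} {β : ℝ} (hβ : 0 < β) (j : Fin d) :
    ContinuousLinearMap.adjoint fourierOp (ket3 d β j) =
      ∑ k : Fin d, (dftCoeff d j k * ((√(N3 d β k / N3 d β j) : ℝ) : ℂ)) • ket3 d β k :=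
  (map_normalized_eq_iff (ContinuousLinearMap.adjoint fourierOp).toLinearMap
    (approx3Vec_ne_zero hβ) (dftCoeff d j) j).2 (adjoint_fourierOp_approx3Vec hβ j)

theorem map_fourierOp_codeSpace3 {d : ℕ} {β : ℝ} (hβ : 0 < β) :
    (codeSpace3 d β).map (fourierOp : L2 →ₗ[ℂ] L2) = codeSpace3 d β := by
  have : FiniteDimensional ℂ (codeSpace3 d β) :=
    FiniteDimensional.span_of_finite ℂ (Set.finite_range _)
  refine map_eq_of_leftInverse
    (A := (ContinuousLinearMap.adjoint fourierOp).toLinearMap) fourierOp_adjoint_fourierOp ?_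
  rw [codeSpace3, Submodule.map_span_le]
  rintro _ ⟨j, rfl⟩
  rw [ContinuousLinearMap.coe_coe, adjoint_fourierOp_ket3 hβ]
  exact Submodule.sum_mem _ fun k _ => Submodule.smul_mem _ _ (Submodule.subset_span ⟨k, rfl⟩)

/-! ### Displacements -/

/-- The transpose of the displacement `V̂(r)`, on Schwartz functions. -/
def weyl (r : ℝ × ℝ) : 𝓢(ℝ, ℂ) →L[ℂ] 𝓢(ℝ, ℂ) :=
  Complex.exp (-Complex.I * r.1 * r.2 / 2) • (compSubConstCLM ℂ (-r.2) ∘L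
    smulLeftCLM ℂ (fun q : ℝ => Complex.exp (Complex.I * r.1 * q)))

theorem dispV_apply (r : ℝ × ℝ) (T : 𝓢'(ℝ, ℂ)) (u : 𝓢(ℝ, ℂ)) : dispV r T u = T (weyl r u) := by
  rw [weyl, smul_apply, map_smul]
  rfl

theorem iteratedDeriv_exp_I_mul (a : ℝ) (n : ℕ) :
    iteratedDeriv n (fun q : ℝ => Complex.exp (Complex.I * a * q)) =
      fun q : ℝ => (Complex.I * a) ^ n * Complex.exp (Complex.I * a * q) := by
  induction n with
  | zero => simp
  | succ n ih =>
    ext q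
    have h : HasDerivAt (fun q : ℝ => Complex.I * a * (q : ℂ)) (Complex.I * a * 1) q :=
      (Complex.ofRealCLM.hasDerivAt (x := q)).const_mul _
    rw [iteratedDeriv_succ, ih, (h.cexp.const_mul _).deriv]
    ring

theorem hasTemperateGrowth_exp_I_mul (a : ℝ) :
    (fun q : ℝ => Complex.exp (Complex.I * a * q)).HasTemperateGrowth := by
  refine ⟨(contDiff_const.mul Complex.ofRealCLM.contDiff).cexp, fun n => ⟨0, |a| ^ n, fun q => ?_⟩⟩
  have hphase : (Complex.I * a * q : ℂ) = ((a * q : ℝ) : ℂ) * Complex.I := by push_cast; ring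
  rw [norm_iteratedFDeriv_eq_norm_iteratedDeriv, iteratedDeriv_exp_I_mul, norm_mul, hphase,
    norm_pow, norm_mul, Complex.norm_exp_ofReal_mul_I, Complex.norm_I, Complex.norm_real, one_mul,
    Real.norm_eq_abs, pow_zero]

theorem weyl_apply (r : ℝ × ℝ) (u : 𝓢(ℝ, ℂ)) (x : ℝ) :
    weyl r u x = Complex.exp (Complex.I * r.1 * (x + r.2 / 2)) * u (x + r.2) := by
  rw [weyl, smul_apply, smul_apply, ContinuousLinearMap.comp_apply, compSubConstCLM_apply,
    smulLeftCLM_apply_apply (hasTemperateGrowth_exp_I_mul _), smul_eq_mul, smul_eq_mul, ← mul_assoc,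
    ← Complex.exp_add, sub_neg_eq_add]
  congr 2
  push_cast
  ring

theorem norm_weyl_apply (r : ℝ × ℝ) (u : 𝓢(ℝ, ℂ)) (x : ℝ) : ‖weyl r u x‖ = ‖u (x + r.2)‖ := by
  have hphase : (Complex.I * r.1 * (x + r.2 / 2) : ℂ) =
    ((r.1 * (x + r.2 / 2) : ℝ) : ℂ) * Complex.I := by push_cast; ring
  rw [weyl_apply, norm_mul, hphase, Complex.norm_exp_ofReal_mul_I, one_mul]

theorem weyl_fourierU (r : ℝ × ℝ) (u : 𝓢(ℝ, ℂ)) :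
    weyl r (fourierU u) = fourierU (weyl (-r.2, r.1) u) := by
  ext y
  rw [weyl_apply, fourierU_apply, fourierU_apply, mul_left_comm, ← integral_const_mul,
    ← integral_add_right_eq_self (fun x : ℝ => Complex.exp (Complex.I * r.1 * (y + r.2 / 2)) *
      (Complex.exp (-Complex.I * x * ((y + r.2 : ℝ) : ℂ)) * u x)) r.1]
  congr 1
  refine integral_congr_ae (Eventually.of_forall fun x => ?_)
  simp only [weyl_apply]
  rw [← mul_assoc, ← mul_assoc, ← Complex.exp_add, ← Complex.exp_add]
  congr 2
  push_cast
  ring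

theorem continuous_uncurry_weyl (u : 𝓢(ℝ, ℂ)) :
    Continuous fun p : (ℝ × ℝ) × ℝ => weyl p.1 u p.2 := by
  have := u.continuous
  simp only [weyl_apply]
  fun_prop

theorem errorWave_eq_mul (γ δ : ℝ) (r : ℝ × ℝ) :
    errorWave γ δ r = (2 * π * γ * δ)⁻¹ * (Real.exp (-(1 / (2 * γ ^ 2)) * r.1 ^ 2) *
      Real.exp (-(1 / (2 * δ ^ 2)) * r.2 ^ 2)) := by
  rw [errorWave, ← Real.exp_add, div_eq_inv_mul]
  congr 2
  ring

theorem continuous_errorWave (γ δ : ℝ) : Continuous (errorWave γ δ) := by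
  unfold errorWave
  fun_prop

theorem exists_schwartzMap_eq_exp_neg_mul_sq {b : ℝ} (hb : 0 < b) (z : ℝ) :
    ∃ g : 𝓢(ℝ, ℝ), ∀ x, g x = Real.exp (-b * (x - z) ^ 2) := by
  have hc : √(2 * b) ≠ 0 := by positivity
  refine ⟨compSubConstCLM ℝ z
    (compCLMOfContinuousLinearEquiv ℝ (dilation _ hc) gaussianSchwartz), fun x => ?_⟩
  change Real.exp (-(dilation _ hc (x - z) ^ 2 / 2)) = _
  rw [dilation_apply, mul_pow, Real.sq_sqrt (by positivity)]
  congr 1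
  ring

theorem integrable_one_add_abs_pow_mul_exp_neg_mul_sq {b : ℝ} (hb : 0 < b) (l : ℕ) :
    Integrable fun x : ℝ => (1 + |x|) ^ l * Real.exp (-b * x ^ 2) := by
  obtain ⟨g, hg⟩ := exists_schwartzMap_eq_exp_neg_mul_sq hb 0
  have hpow : ∀ x : ℝ, (1 + |x|) ^ l * Real.exp (-b * x ^ 2) =
      ∑ i ∈ Finset.range (l + 1), |x| ^ i * ‖g x‖ * l.choose i := fun x => by
    rw [hg, sub_zero, Real.norm_of_nonneg (Real.exp_pos _).le, add_comm, add_pow, Finset.sum_mul]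
    exact Finset.sum_congr rfl fun i _ => by ring
  simp only [hpow]
  exact integrable_finsetSum _ fun i _ => (g.integrable_pow_mul volume i).mul_const _

theorem integrable_errorWave_mul_pow {γ δ : ℝ} (hγ : γ ≠ 0) (hδ : δ ≠ 0) (l : ℕ) :
    Integrable fun r : ℝ × ℝ => errorWave γ δ r * (1 + |r.2|) ^ l := by
  have h₁ := integrable_exp_neg_mul_sq (b := 1 / (2 * γ ^ 2)) (by positivity)
  have h₂ := integrable_one_add_abs_pow_mul_exp_neg_mul_sq (b := 1 / (2 * δ ^ 2)) (by positivity) l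
  refine ((h₁.mul_prod h₂).const_mul (2 * π * γ * δ)⁻¹).congr (Eventually.of_forall fun r => ?_)
  simp only [errorWave_eq_mul]
  ring

theorem exists_norm_apply_add_le (u : 𝓢(ℝ, ℂ)) (l : ℕ) :
    ∃ C, ∀ x y : ℝ, ‖u (y + x)‖ ≤ C * (1 + |x|) ^ l * (1 + ‖y‖) ^ (-(l : ℝ)) := by
  refine ⟨2 ^ l * (Finset.Iic (l, 0)).sup (fun m => SchwartzMap.seminorm ℝ m.1 m.2) u,
    fun x y => ?_⟩
  have hdecay := one_add_le_sup_seminorm_apply (𝕜 := ℝ) (m := (l, 0)) le_rfl le_rfl u (y + x)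
  rw [norm_iteratedFDeriv_zero] at hdecay
  have hPeetre : 1 + ‖y‖ ≤ (1 + ‖y + x‖) * (1 + |x|) := by
    have h := norm_sub_le (y + x) x
    rw [add_sub_cancel_right, Real.norm_eq_abs x] at h
    nlinarith [mul_nonneg (norm_nonneg (y + x)) (abs_nonneg x)]
  rw [Real.rpow_neg (by positivity), Real.rpow_natCast, ← div_eq_mul_inv,
    le_div_iff₀ (by positivity)]
  calc ‖u (y + x)‖ * (1 + ‖y‖) ^ l
      ≤ ‖u (y + x)‖ * ((1 + ‖y + x‖) * (1 + |x|)) ^ l := by gcongr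
    _ = (1 + ‖y + x‖) ^ l * ‖u (y + x)‖ * (1 + |x|) ^ l := by rw [mul_pow]; ring
    _ ≤ _ := mul_le_mul_of_nonneg_right hdecay (by positivity)

theorem integrable_errorWave_mul_weyl_prod {γ δ : ℝ} (hγ : γ ≠ 0) (hδ : δ ≠ 0) (μ : Measure ℝ)
    [SFinite μ] [μ.HasTemperateGrowth] (u : 𝓢(ℝ, ℂ)) :
    Integrable (fun p : (ℝ × ℝ) × ℝ => (errorWave γ δ p.1 : ℂ) * weyl p.1 u p.2)
      (volume.prod μ) := by
  obtain ⟨C, hC⟩ := exists_norm_apply_add_le u μ.integrablePower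
  refine (((integrable_errorWave_mul_pow hγ hδ μ.integrablePower).norm.mul_prod
    μ.integrable_pow_neg_integrablePower).const_mul C).mono' ?_ (Eventually.of_forall fun p => ?_)
  · have := continuous_errorWave γ δ
    have := continuous_uncurry_weyl u
    exact Continuous.aestronglyMeasurable (by fun_prop)
  · rw [norm_mul, Complex.norm_real, norm_weyl_apply, norm_mul, Real.norm_of_nonneg
      (by positivity : (0 : ℝ) ≤ (1 + |p.1.2|) ^ μ.integrablePower)]
    calc _ ≤ ‖errorWave γ δ p.1‖ * (C * (1 + |p.1.2|) ^ μ.integrablePower *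
          (1 + ‖p.2‖) ^ (-(μ.integrablePower : ℝ))) := by gcongr; exact hC _ _
      _ = _ := by ring

/-! ### Gaussian mixtures of displacements -/

/-- The integral kernel of the Gaussian mixture of displacements `∬ errorWave(r) V̂(r) dr`. -/
def gaussKernel (γ δ x y : ℝ) : ℝ :=
  √(2 * π * γ ^ 2) / (2 * π * γ * δ) *
    Real.exp (-((x - y) ^ 2 / (2 * δ ^ 2)) - γ ^ 2 * (x + y) ^ 2 / 8)

theorem continuous_uncurry_gaussKernel (γ δ : ℝ) :
    Continuous fun p : ℝ × ℝ => gaussKernel γ δ p.1 p.2 := by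
  unfold gaussKernel
  fun_prop

theorem gaussKernel_nonneg {γ δ : ℝ} (h : 0 ≤ γ * δ) (x y : ℝ) : 0 ≤ gaussKernel γ δ x y := by
  rw [gaussKernel, mul_assoc (2 * π)]
  positivity

theorem integral_exp_I_mul_mul_exp_neg_mul_sq {γ : ℝ} (hγ : γ ≠ 0) (t : ℝ) :
    ∫ r : ℝ, Complex.exp (Complex.I * t * r) * Complex.exp (-(1 / (2 * γ ^ 2)) * r ^ 2) =
      ((√(2 * π * γ ^ 2) * Real.exp (-(γ ^ 2 * t ^ 2 / 2)) : ℝ) : ℂ) := by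
  have hγ' : (γ : ℂ) ≠ 0 := Complex.ofReal_ne_zero.2 hγ
  have hwidth : (1 / (2 * γ ^ 2) : ℂ) = ((1 / (2 * γ ^ 2) : ℝ) : ℂ) := by push_cast; rfl
  rw [fourierIntegral_gaussian (by rw [hwidth, Complex.ofReal_re]; positivity), Real.sqrt_eq_rpow,
    Complex.ofReal_mul, Complex.ofReal_cpow (by positivity)]
  push_cast
  congr 2 <;> field_simp
  ring

theorem integral_errorWave_mul_weyl {γ δ : ℝ} (hγ : γ ≠ 0) (u : 𝓢(ℝ, ℂ)) {y : ℝ}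
    (hint : Integrable fun r : ℝ × ℝ => (errorWave γ δ r : ℂ) * weyl r u y) :
    ∫ r : ℝ × ℝ, (errorWave γ δ r : ℂ) * weyl r u y = ∫ x, (gaussKernel γ δ x y : ℂ) * u x := by
  rw [Measure.volume_eq_prod, integral_prod_symm _ hint,
    ← integral_add_left_eq_self (fun x => (gaussKernel γ δ x y : ℂ) * u x) y]
  refine integral_congr_ae (Eventually.of_forall fun r₂ => ?_)
  have hsplit : ∀ r₁ : ℝ, (errorWave γ δ (r₁, r₂) : ℂ) * weyl (r₁, r₂) u y =
      (2 * π * γ * δ)⁻¹ * Real.exp (-(1 / (2 * δ ^ 2)) * r₂ ^ 2) * u (y + r₂) *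
        (Complex.exp (Complex.I * (y + r₂ / 2 : ℝ) * r₁) *
          Complex.exp (-(1 / (2 * γ ^ 2)) * r₁ ^ 2)) := fun r₁ => by
    rw [errorWave_eq_mul, weyl_apply]
    push_cast
    rw [mul_right_comm Complex.I]
    ring
  have hkernel : gaussKernel γ δ (y + r₂) y = (2 * π * γ * δ)⁻¹ *
      Real.exp (-(1 / (2 * δ ^ 2)) * r₂ ^ 2) *
        (√(2 * π * γ ^ 2) * Real.exp (-(γ ^ 2 * (y + r₂ / 2) ^ 2 / 2))) := by
    rw [gaussKernel, mul_mul_mul_comm, ← Real.exp_add, div_eq_inv_mul]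
    congr 2
    ring
  simp only [hsplit, integral_const_mul, hkernel, integral_exp_I_mul_mul_exp_neg_mul_sq hγ]
  push_cast
  ring

/-- The decay rate in `x` of the wave functions that `gaussKernel` produces from periodic data. -/
def waveRate (γ δ : ℝ) : ℝ := 2 * γ ^ 2 / (4 + γ ^ 2 * δ ^ 2)

/-- Completing the square in `y`. -/
theorem gaussKernel_eq_mul_exp_mul_exp {γ δ : ℝ} (hδ : δ ≠ 0) (x y : ℝ) :
    gaussKernel γ δ x y =
      √(2 * π * γ ^ 2) / (2 * π * γ * δ) * Real.exp (-waveRate γ δ * x ^ 2) *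
        Real.exp (-((4 + γ ^ 2 * δ ^ 2) / (8 * δ ^ 2)) *
          (y - (4 - γ ^ 2 * δ ^ 2) / (4 + γ ^ 2 * δ ^ 2) * x) ^ 2) := by
  rw [gaussKernel, waveRate, mul_assoc (_ / _), ← Real.exp_add]
  congr 2
  field_simp
  ring

theorem integrable_exp_neg_mul_sq_sub {b : ℝ} (hb : 0 < b) (z : ℝ) (μ : Measure ℝ)
    [μ.HasTemperateGrowth] : Integrable (fun y => Real.exp (-b * (y - z) ^ 2)) μ := by
  obtain ⟨g, hg⟩ := exists_schwartzMap_eq_exp_neg_mul_sq hb z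
  exact g.integrable.congr (Eventually.of_forall hg)

theorem integrable_gaussKernel {γ δ : ℝ} (hδ : δ ≠ 0) (x : ℝ) (μ : Measure ℝ)
    [μ.HasTemperateGrowth] : Integrable (gaussKernel γ δ x) μ := by
  have h := (integrable_exp_neg_mul_sq_sub (b := (4 + γ ^ 2 * δ ^ 2) / (8 * δ ^ 2)) (by positivity)
    ((4 - γ ^ 2 * δ ^ 2) / (4 + γ ^ 2 * δ ^ 2) * x) μ).const_mul
      (√(2 * π * γ ^ 2) / (2 * π * γ * δ) * Real.exp (-waveRate γ δ * x ^ 2))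
  exact h.congr (Eventually.of_forall fun y => (gaussKernel_eq_mul_exp_mul_exp hδ x y).symm)

theorem periodic_integral_exp_neg_mul_sq_sub {T : ℝ} {μ : Measure ℝ} (hμ : μ.map (· + T) = μ)
    (b : ℝ) : Function.Periodic (fun z => ∫ y, Real.exp (-b * (y - z) ^ 2) ∂μ) T := fun z => by
  have hT : Measurable (· + T) := by fun_prop
  dsimp only
  conv_lhs => rw [← hμ]
  rw [integral_map hT.aemeasurable (Continuous.aestronglyMeasurable (by fun_prop))]
  simp only [add_sub_add_right_eq_sub]

theorem exists_integral_exp_neg_mul_sq_sub_mem_Icc {T b : ℝ} (hT : 0 < T) (hb : 0 < b)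
    {μ : Measure ℝ} [NeZero μ] [μ.HasTemperateGrowth] (hμ : μ.map (· + T) = μ) :
    ∃ m M : ℝ, 0 < m ∧ ∀ z, ∫ y, Real.exp (-b * (y - z) ^ 2) ∂μ ∈ Set.Icc m M := by
  have hlow := integrable_exp_neg_mul_sq_sub (b := 2 * b) (by positivity) 0 μ
  have hupp := integrable_exp_neg_mul_sq_sub (b := b / 2) (by positivity) 0 μ
  refine ⟨Real.exp (-2 * b * T ^ 2) * ∫ y, Real.exp (-(2 * b) * (y - 0) ^ 2) ∂μ,
    Real.exp (b * T ^ 2) * ∫ y, Real.exp (-(b / 2) * (y - 0) ^ 2) ∂μ,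
    mul_pos (Real.exp_pos _) (integral_exp_pos hlow), fun z => ?_⟩
  obtain ⟨w, hw, hzw⟩ := (periodic_integral_exp_neg_mul_sq_sub hμ b).exists_mem_Ico₀ hT z
  have hwT : b * w ^ 2 ≤ b * T ^ 2 :=
    mul_le_mul_of_nonneg_left (pow_le_pow_left₀ hw.1 hw.2.le 2) hb.le
  have hint := integrable_exp_neg_mul_sq_sub hb w μ
  rw [hzw, ← integral_const_mul, ← integral_const_mul]
  refine ⟨integral_mono (hlow.const_mul _) hint fun y => ?_,
    integral_mono hint (hupp.const_mul _) fun y => ?_⟩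
  · simp only [← Real.exp_add]
    exact Real.exp_le_exp.2 (by nlinarith [mul_nonneg hb.le (sq_nonneg (y + w))])
  · simp only [← Real.exp_add]
    exact Real.exp_le_exp.2 (by nlinarith [mul_nonneg hb.le (sq_nonneg (y - 2 * w))])

/-- The wave function obtained by applying `gaussKernel` to a measure, such as a Dirac comb. -/
def gaussWave (μ : Measure ℝ) (γ δ x : ℝ) : ℝ := ∫ y, gaussKernel γ δ x y ∂μ

theorem exists_gaussWave_mem_Icc {T : ℝ} (hT : 0 < T) {μ : Measure ℝ} [NeZero μ]
    [μ.HasTemperateGrowth] (hμ : μ.map (· + T) = μ) {γ δ : ℝ} (h : 0 < γ * δ) :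
    ∃ m M : ℝ, 0 < m ∧ ∀ x, gaussWave μ γ δ x ∈
      Set.Icc (m * Real.exp (-waveRate γ δ * x ^ 2)) (M * Real.exp (-waveRate γ δ * x ^ 2)) := by
  have hγ : γ ≠ 0 := left_ne_zero_of_mul h.ne'
  have hδ : δ ≠ 0 := right_ne_zero_of_mul h.ne'
  have hc : 0 < √(2 * π * γ ^ 2) / (2 * π * γ * δ) := by
    rw [mul_assoc (2 * π)]
    positivity
  obtain ⟨m, M, hm, hmM⟩ := exists_integral_exp_neg_mul_sq_sub_mem_Icc hT
    (b := (4 + γ ^ 2 * δ ^ 2) / (8 * δ ^ 2)) (by positivity) hμ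
  refine ⟨√(2 * π * γ ^ 2) / (2 * π * γ * δ) * m, √(2 * π * γ ^ 2) / (2 * π * γ * δ) * M,
    mul_pos hc hm, fun x => ?_⟩
  have hwave : gaussWave μ γ δ x = _ :=
    integral_congr_ae (Eventually.of_forall fun y => gaussKernel_eq_mul_exp_mul_exp hδ x y)
  rw [hwave, integral_const_mul, mul_right_comm _ m, mul_right_comm _ M]
  have hpos := (mul_pos hc (Real.exp_pos (-waveRate γ δ * x ^ 2))).le
  exact ⟨mul_le_mul_of_nonneg_left (hmM _).1 hpos, mul_le_mul_of_nonneg_left (hmM _).2 hpos⟩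

theorem stronglyMeasurable_gaussWave (μ : Measure ℝ) [SFinite μ] (γ δ : ℝ) :
    StronglyMeasurable (gaussWave μ γ δ) :=
  (continuous_uncurry_gaussKernel γ δ).stronglyMeasurable.integral_prod_right

theorem waveRate_pos {γ : ℝ} (hγ : γ ≠ 0) (δ : ℝ) : 0 < waveRate γ δ := by
  unfold waveRate
  positivity

theorem integrable_errorWave_mul_integral_weyl {γ δ : ℝ} (hγ : γ ≠ 0) (hδ : δ ≠ 0) (μ : Measure ℝ)
    [SFinite μ] [μ.HasTemperateGrowth] (u : 𝓢(ℝ, ℂ)) :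
    Integrable fun r : ℝ × ℝ => (errorWave γ δ r : ℂ) * ∫ y, weyl r u y ∂μ := by
  simpa only [integral_const_mul] using
    (integrable_errorWave_mul_weyl_prod hγ hδ μ u).integral_prod_left

section

variable {T : ℝ} {μ : Measure ℝ} [SFinite μ] [NeZero μ] [μ.HasTemperateGrowth]

theorem memLp_gaussWave (hT : 0 < T) (hμ : μ.map (· + T) = μ) {γ δ : ℝ} (h : 0 < γ * δ) :
    MemLp (gaussWave μ γ δ) 2 := by
  obtain ⟨m, M, hm, hmM⟩ := exists_gaussWave_mem_Icc hT hμ h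
  obtain ⟨g, hg⟩ := exists_schwartzMap_eq_exp_neg_mul_sq
    (waveRate_pos (left_ne_zero_of_mul h.ne') δ) 0
  refine ((g.memLp 2).const_mul M).mono' (stronglyMeasurable_gaussWave μ γ δ).aestronglyMeasurable
    (Eventually.of_forall fun x => ?_)
  have hpos := (mul_pos hm (Real.exp_pos (-waveRate γ δ * x ^ 2))).le.trans (hmM x).1
  simpa only [Real.norm_of_nonneg hpos, hg, sub_zero] using (hmM x).2

theorem integrable_gaussKernel_mul_prod (hT : 0 < T) (hμ : μ.map (· + T) = μ) {γ δ : ℝ}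
    (h : 0 < γ * δ) (u : 𝓢(ℝ, ℂ)) :
    Integrable (fun p : ℝ × ℝ => (gaussKernel γ δ p.1 p.2 : ℂ) * u p.1) (volume.prod μ) := by
  have hK := continuous_uncurry_gaussKernel γ δ
  have hu := u.continuous
  have hnorm : ∀ x y, ‖(gaussKernel γ δ x y : ℂ) * u x‖ = gaussKernel γ δ x y * ‖u x‖ :=
    fun x y => by
      rw [norm_mul, Complex.norm_real, Real.norm_of_nonneg (gaussKernel_nonneg h.le x y)]
  refine (integrable_prod_iff (Continuous.aestronglyMeasurable (by fun_prop))).2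
    ⟨Eventually.of_forall fun x => ?_, ?_⟩
  · have hx : Integrable (fun y => (gaussKernel γ δ x y : ℂ)) μ :=
      (integrable_gaussKernel (right_ne_zero_of_mul h.ne') x μ).ofReal
    exact hx.mul_const (u x)
  · simp only [hnorm, integral_mul_const]
    have hu2 : MemLp (fun x => ‖u x‖) 2 := (u.memLp 2).norm
    exact (memLp_gaussWave hT hμ h).integrable_mul hu2

theorem integral_errorWave_mul_integral_weyl (hT : 0 < T) (hμ : μ.map (· + T) = μ) {γ δ : ℝ}
    (h : 0 < γ * δ) (u : 𝓢(ℝ, ℂ)) :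
    ∫ r : ℝ × ℝ, (errorWave γ δ r : ℂ) * ∫ y, weyl r u y ∂μ =
      ∫ x, (gaussWave μ γ δ x : ℂ) * u x := by
  have hγ : γ ≠ 0 := left_ne_zero_of_mul h.ne'
  have hδ : δ ≠ 0 := right_ne_zero_of_mul h.ne'
  have hint := integrable_errorWave_mul_weyl_prod hγ hδ μ u
  calc ∫ r : ℝ × ℝ, (errorWave γ δ r : ℂ) * ∫ y, weyl r u y ∂μ
      = ∫ r : ℝ × ℝ, ∫ y, (errorWave γ δ r : ℂ) * weyl r u y ∂μ := by
        simp only [integral_const_mul]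
    _ = ∫ y, (∫ r : ℝ × ℝ, (errorWave γ δ r : ℂ) * weyl r u y) ∂μ := integral_integral_swap hint
    _ = ∫ y, (∫ x, (gaussKernel γ δ x y : ℂ) * u x) ∂μ := by
        refine integral_congr_ae (hint.prod_left_ae.mono fun y hy => ?_)
        exact integral_errorWave_mul_weyl hγ u hy
    _ = ∫ x, ∫ y, (gaussKernel γ δ x y : ℂ) * u x ∂μ :=
        (integral_integral_swap (integrable_gaussKernel_mul_prod hT hμ h u)).symm
    _ = ∫ x, (gaussWave μ γ δ x : ℂ) * u x := by
        simp only [integral_mul_const, integral_complex_ofReal, gaussWave]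

end

/-! ### The displacement-averaged code states -/

theorem map_add_codeComb (d : ℕ) (j : Fin d) :
    (codeComb d j).map (· + alpha d * d) = codeComb d j :=
  map_add_diracComb _ _

/-- The wave function of the unnormalized Approximation 2 state `approx2Vec d γ δ j`. -/
def codeWave (d : ℕ) (γ δ : ℝ) (j : Fin d) (x : ℝ) : ℝ :=
  √(alpha d * d) * gaussWave (codeComb d j) γ δ x

theorem exists_codeWave_mem_Icc {d : ℕ} {γ δ : ℝ} (h : 0 < γ * δ) (j : Fin d) :
    ∃ m M : ℝ, 0 < m ∧ ∀ x, codeWave d γ δ j x ∈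
      Set.Icc (m * Real.exp (-waveRate γ δ * x ^ 2)) (M * Real.exp (-waveRate γ δ * x ^ 2)) := by
  obtain ⟨m, M, hm, hmM⟩ :=
    exists_gaussWave_mem_Icc (codeComb_period_pos j) (map_add_codeComb d j) h
  have hT : 0 < √(alpha d * d) := Real.sqrt_pos.2 (codeComb_period_pos j)
  refine ⟨√(alpha d * d) * m, √(alpha d * d) * M, mul_pos hT hm, fun x => ?_⟩
  rw [mul_assoc, mul_assoc]
  exact ⟨mul_le_mul_of_nonneg_left (hmM x).1 hT.le, mul_le_mul_of_nonneg_left (hmM x).2 hT.le⟩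

theorem memLp_codeWave {d : ℕ} {γ δ : ℝ} (h : 0 < γ * δ) (j : Fin d) :
    MemLp (fun x => (codeWave d γ δ j x : ℂ)) 2 :=
  ((memLp_gaussWave (codeComb_period_pos j) (map_add_codeComb d j) h).const_mul _).ofReal

theorem isApprox2Vec_toLp_codeWave {d : ℕ} {γ δ : ℝ} (h : 0 < γ * δ) (j : Fin d) :
    IsApprox2Vec d γ δ j (memLp_codeWave h j).toLp := fun u => by
  have hdisp : ∀ r : ℝ × ℝ, (errorWave γ δ r : ℂ) * dispV r (idealState d j) u =
      ((√(alpha d * d) : ℝ) : ℂ) * ((errorWave γ δ r : ℂ) * ∫ y, weyl r u y ∂codeComb d j) :=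
    fun r => by rw [dispV_apply, idealState_apply, mul_left_comm]
  simp only [hdisp]
  refine ⟨(integrable_errorWave_mul_integral_weyl (left_ne_zero_of_mul h.ne')
    (right_ne_zero_of_mul h.ne') _ u).const_mul _, ?_⟩
  rw [integral_const_mul, integral_errorWave_mul_integral_weyl (codeComb_period_pos j)
    (map_add_codeComb d j) h, Lp.toTemperedDistribution_apply, ← integral_const_mul]
  refine integral_congr_ae ?_
  filter_upwards [(memLp_codeWave h j).coeFn_toLp] with x hx
  rw [hx, codeWave, smul_eq_mul, Complex.ofReal_mul]
  ring

theorem eq_of_isApprox2Vec {d : ℕ} {γ δ : ℝ} {j : Fin d} {f g : L2}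
    (hf : IsApprox2Vec d γ δ j f) (hg : IsApprox2Vec d γ δ j g) : f = g :=
  ext_inner_fock fun n => by
    rw [← toTemperedDistribution_fockS, ← toTemperedDistribution_fockS, (hf _).2, (hg _).2]

theorem isApprox2Vec_approx2Vec {d : ℕ} {γ δ : ℝ} (h : 0 < γ * δ) (j : Fin d) :
    IsApprox2Vec d γ δ j (approx2Vec d γ δ j) := by
  have hex : ∃ f, IsApprox2Vec d γ δ j f := ⟨_, isApprox2Vec_toLp_codeWave h j⟩
  rw [approx2Vec, dif_pos hex]
  exact hex.choose_spec

theorem approx2Vec_ae_eq {d : ℕ} {γ δ : ℝ} (h : 0 < γ * δ) (j : Fin d) :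
    approx2Vec d γ δ j =ᵐ[volume] fun x => (codeWave d γ δ j x : ℂ) := by
  rw [eq_of_isApprox2Vec (isApprox2Vec_approx2Vec h j) (isApprox2Vec_toLp_codeWave h j)]
  exact (memLp_codeWave h j).coeFn_toLp

theorem approx2Vec_ne_zero {d : ℕ} {γ δ : ℝ} (h : 0 < γ * δ) (j : Fin d) :
    approx2Vec d γ δ j ≠ 0 := by
  intro hzero
  have hae := approx2Vec_ae_eq h j
  rw [hzero] at hae
  obtain ⟨x, h0, hx⟩ := ((Lp.coeFn_zero ℂ 2 volume).and hae).exists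
  obtain ⟨m, M, hm, hmM⟩ := exists_codeWave_mem_Icc h j
  have hpos := (mul_pos hm (Real.exp_pos (-waveRate γ δ * x ^ 2))).trans_le (hmM x).1
  exact hpos.ne' (Complex.ofReal_eq_zero.1 (hx.symm.trans h0))

theorem errorWave_rotate (γ δ : ℝ) (r : ℝ × ℝ) : errorWave δ γ (-r.2, r.1) = errorWave γ δ r := by
  rw [errorWave, errorWave, neg_sq, mul_right_comm _ δ γ, neg_sub_comm]

theorem integral_rotate {E : Type*} [NormedAddCommGroup E] [NormedSpace ℝ E] (f : ℝ × ℝ → E) :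
    ∫ r : ℝ × ℝ, f (-r.2, r.1) = ∫ r, f r := by
  have hpres : MeasurePreserving (fun r : ℝ × ℝ => (-r.2, r.1)) :=
    ((Measure.measurePreserving_neg (volume : Measure ℝ)).prod (MeasurePreserving.id volume)).comp
      Measure.measurePreserving_swap
  have hemb : MeasurableEmbedding (fun r : ℝ × ℝ => (-r.2, r.1)) :=
    (MeasurableEquiv.prodComm.trans
      ((MeasurableEquiv.neg ℝ).prodCongr (MeasurableEquiv.refl ℝ))).measurableEmbedding
  exact hpres.integral_comp hemb f

theorem adjoint_fourierOp_approx2Vec {d : ℕ} {γ δ : ℝ} (h : 0 < γ * δ) (j : Fin d) :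
    ContinuousLinearMap.adjoint fourierOp (approx2Vec d γ δ j) =
      ∑ k, dftCoeff d j k • approx2Vec d δ γ k := by
  refine ext_inner_fock fun n => ?_
  have hswap : ∀ k : Fin d, _ := fun k => isApprox2Vec_approx2Vec (mul_comm γ δ ▸ h) k (fockS n)
  have hrot : ∀ r : ℝ × ℝ, (errorWave γ δ r : ℂ) * dispV r (idealState d j) (fourierU (fockS n)) =
      ∑ k, dftCoeff d j k * ((errorWave δ γ (-r.2, r.1) : ℂ) *
        dispV (-r.2, r.1) (idealState d k) (fockS n)) := fun r => by
    simp only [errorWave_rotate, dispV_apply]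
    rw [weyl_fourierU, idealState_fourierU, Finset.mul_sum]
    exact Finset.sum_congr rfl fun k _ => mul_left_comm _ _ _
  calc ⟪fock n, ContinuousLinearMap.adjoint fourierOp (approx2Vec d γ δ j)⟫_ℂ
      = (approx2Vec d γ δ j : 𝓢'(ℝ, ℂ)) (fourierU (fockS n)) := by
        rw [inner_fock_adjoint_fourierOp, ← toTemperedDistribution_fockS, fourierU_fockS, map_smul,
          smul_eq_mul]
    _ = ∫ r : ℝ × ℝ, ∑ k, dftCoeff d j k * ((errorWave δ γ r : ℂ) *
          dispV r (idealState d k) (fockS n)) := by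
        rw [(isApprox2Vec_approx2Vec h j _).2]
        simp only [hrot]
        exact integral_rotate fun r => ∑ k, dftCoeff d j k * ((errorWave δ γ r : ℂ) *
          dispV r (idealState d k) (fockS n))
    _ = ⟪fock n, ∑ k, dftCoeff d j k • approx2Vec d δ γ k⟫_ℂ := by
        rw [integral_finsetSum _ fun k _ => (hswap k).1.const_mul _, inner_sum]
        simp only [inner_smul_right, ← toTemperedDistribution_fockS, (hswap _).2,
          integral_const_mul]

theorem le_of_frequently_mul_exp_neg_mul_sq_le {a b m M : ℝ} (hm : 0 < m)
    (h : ∃ᶠ x : ℝ in atTop, m * Real.exp (-a * x ^ 2) ≤ M * Real.exp (-b * x ^ 2)) : b ≤ a := by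
  by_contra! hab
  have hlim : Tendsto (fun x : ℝ => M * Real.exp (-((b - a) * x ^ 2))) atTop (𝓝 (M * 0)) :=
    (Real.tendsto_exp_neg_atTop_nhds_zero.comp
      ((tendsto_pow_atTop two_ne_zero).const_mul_atTop (sub_pos.2 hab))).const_mul M
  rw [mul_zero] at hlim
  obtain ⟨x, hle, hlt⟩ := (h.and_eventually (hlim.eventually_lt_const hm)).exists
  have hfactor : M * Real.exp (-b * x ^ 2) =
      M * Real.exp (-((b - a) * x ^ 2)) * Real.exp (-a * x ^ 2) := by
    rw [mul_assoc, ← Real.exp_add]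
    congr 2
    ring
  rw [hfactor] at hle
  exact hlt.not_ge (le_of_mul_le_mul_right hle (Real.exp_pos _))

theorem frequently_atTop_of_ae {p : ℝ → Prop} (h : ∀ᵐ x, p x) : ∃ᶠ x in atTop, p x := by
  refine frequently_atTop.2 fun a => ?_
  obtain ⟨x, hx, hax⟩ := (Measure.dense_of_ae h).exists_ge a
  exact ⟨x, hax, hx⟩

theorem waveRate_le_of_approx2Vec_eq {d : ℕ} {γ δ γ' δ' : ℝ} (h : 0 < γ * δ) (h' : 0 < γ' * δ')
    {j : Fin d} (heq : approx2Vec d γ δ j = approx2Vec d γ' δ' j) :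
    waveRate γ' δ' ≤ waveRate γ δ := by
  obtain ⟨m, _, hm, hlow⟩ := exists_codeWave_mem_Icc h j
  obtain ⟨_, M, _, hupp⟩ := exists_codeWave_mem_Icc h' j
  refine le_of_frequently_mul_exp_neg_mul_sq_le hm (M := M) (frequently_atTop_of_ae ?_)
  filter_upwards [approx2Vec_ae_eq h j, approx2Vec_ae_eq h' j] with x hx hx'
  rw [← heq, hx] at hx'
  exact (hlow x).1.trans (Complex.ofReal_injective hx' ▸ (hupp x).2)

theorem eq_of_waveRate_comm {γ δ : ℝ} (h : 0 < γ * δ) (heq : waveRate γ δ = waveRate δ γ) :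
    γ = δ := by
  have hsq : γ ^ 2 = δ ^ 2 := by
    rw [waveRate, waveRate, mul_comm (δ ^ 2), div_left_inj' (by positivity)] at heq
    exact mul_left_cancel₀ two_ne_zero heq
  refine (sq_eq_sq_iff_eq_or_eq_neg.1 hsq).resolve_right fun hneg => ?_
  rw [hneg, neg_mul] at h
  exact (neg_pos.1 h).not_ge (mul_self_nonneg δ)

theorem adjoint_fourierOp_approx2Vec_eq_iff {d : ℕ} {γ δ : ℝ} (h : 0 < γ * δ) (j : Fin d) :
    ContinuousLinearMap.adjoint fourierOp (approx2Vec d γ δ j) =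
      ∑ k, dftCoeff d j k • approx2Vec d γ δ k ↔ γ = δ := by
  have h' : 0 < δ * γ := mul_comm γ δ ▸ h
  refine ⟨fun hF => ?_, fun heq => by subst heq; exact adjoint_fourierOp_approx2Vec h j⟩
  rw [← adjoint_fourierOp_approx2Vec h'] at hF
  have hvec : approx2Vec d γ δ j = approx2Vec d δ γ j :=
    (show Function.LeftInverse _ _ from fourierOp_adjoint_fourierOp).injective hF
  exact eq_of_waveRate_comm h (le_antisymm (waveRate_le_of_approx2Vec_eq h' h hvec.symm)
    (waveRate_le_of_approx2Vec_eq h h' hvec))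

theorem adjoint_fourierOp_ket2_iff {d : ℕ} {γ δ : ℝ} (h : 0 < γ * δ) (j : Fin d) :
    ContinuousLinearMap.adjoint fourierOp (ket2 d γ δ j) =
      ∑ k : Fin d, (dftCoeff d j k * ((√(N2 d γ δ k / N2 d γ δ j) : ℝ) : ℂ)) • ket2 d γ δ k ↔
        γ = δ :=
  (map_normalized_eq_iff (ContinuousLinearMap.adjoint fourierOp).toLinearMap
    (approx2Vec_ne_zero h) (dftCoeff d j) j).trans (adjoint_fourierOp_approx2Vec_eq_iff h j)

end GKP

end

theorem corollary2_general (d : ℕ) :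
    (∀ β : ℝ, 0 < β →
      (∀ j : Fin d, 0 < GKP.N3 d β j) ∧
      (∀ j : Fin d, ContinuousLinearMap.adjoint GKP.fourierOp (GKP.ket3 d β j) =
        ∑ k : Fin d, (GKP.dftCoeff d j k * ((√(GKP.N3 d β k / GKP.N3 d β j) : ℝ) : ℂ)) •
          GKP.ket3 d β k) ∧
      Submodule.map (GKP.fourierOp : GKP.L2 →ₗ[ℂ] GKP.L2) (GKP.codeSpace3 d β) =
        GKP.codeSpace3 d β) ∧
    (∀ γ δ : ℝ, 0 < γ * δ →
      (∀ j : Fin d, 0 < GKP.N2 d γ δ j) ∧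
      (∀ j : Fin d, ContinuousLinearMap.adjoint GKP.fourierOp (GKP.ket2 d γ δ j) =
          ∑ k : Fin d, (GKP.dftCoeff d j k * ((√(GKP.N2 d γ δ k / GKP.N2 d γ δ j) : ℝ) : ℂ)) •
            GKP.ket2 d γ δ k ↔ γ = δ)) := by
  refine ⟨fun β hβ => ⟨fun j => ?_, GKP.adjoint_fourierOp_ket3 hβ, GKP.map_fourierOp_codeSpace3 hβ⟩,
    fun γ δ h => ⟨fun j => ?_, GKP.adjoint_fourierOp_ket2_iff h⟩⟩
  · exact pow_pos (norm_pos_iff.2 (GKP.approx3Vec_ne_zero hβ j)) 2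
  · exact pow_pos (norm_pos_iff.2 (GKP.approx2Vec_ne_zero h j)) 2

theorem corollary2 (d : ℕ) (hd : 0 < d) :
    (∀ β : ℝ, 0 < β →
      (∀ j : Fin d, 0 < GKP.N3 d β j) ∧
      (∀ j : Fin d, ContinuousLinearMap.adjoint GKP.fourierOp (GKP.ket3 d β j) =
        ∑ k : Fin d, (GKP.dftCoeff d j k * ((√(GKP.N3 d β k / GKP.N3 d β j) : ℝ) : ℂ)) •
          GKP.ket3 d β k) ∧
      Submodule.map (GKP.fourierOp : GKP.L2 →ₗ[ℂ] GKP.L2) (GKP.codeSpace3 d β) =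
        GKP.codeSpace3 d β) ∧
    (∀ γ δ : ℝ, 0 < γ * δ → γ * δ < 2 →
      (∀ j : Fin d, 0 < GKP.N2 d γ δ j) ∧
      (∀ j : Fin d, ContinuousLinearMap.adjoint GKP.fourierOp (GKP.ket2 d γ δ j) =
          ∑ k : Fin d, (GKP.dftCoeff d j k * ((√(GKP.N2 d γ δ k / GKP.N2 d γ δ j) : ℝ) : ℂ)) •
            GKP.ket2 d γ δ k ↔ γ = δ)) :=
  ⟨(corollary2_general d).1, fun γ δ h _ => (corollary2_general d).2 γ δ h⟩
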